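/- For $\lambda>0$ let $\mathcal N_\lambda:\mathbb R^3\to\mathbb R$ be given by $\mathcal N_\lambda(0)=0$ and, for $x\neq 0$, $$\mathcal N_\lambda(x) = (x_1^2+x_2^2+x_3^2)^{1/2}\Big(1+\lambda\,\frac{x_1^2+x_2^2-2x_3^2}{x_1^2+x_2^2+x_3^2}\Big)^4 .$$ For $q>0$ let $L_q=L_q([0,1])$ be the space of real functions with $\|f\|_q=\big(\int_0^1|f(t)|^q\,dt\big)^{1/q}<\infty$ (modulo equality almost everywhere), and say that a real normed space $X$ is isometric to a subspace of $L_q$ (embeds isometrically in $L_q$) if there is a linear map $T:X\to L_q$ with $\|Tx\|_q=\|x\|$ for all $x\in X$. Then, for every $\lambda>0$: 1. $\mathcal N_\lambda$ is a norm on $\mathbb R^3$ if and only if $\lambda\le\frac1{23}$. 2. Whenever $\mathcal N_\lambda$ is a norm, let $X_\lambda$ be the space $\mathbb R^3$ with the norm $\mathcal N_\lambda$. Then $X_\lambda$ is isometric to a subspace of $L_{1/4}$ if and only if $\lambda\le\frac1{26}$, and $X_\lambda$ is not isometric to a subspace of $L_{1/2}$ if $\lambda>\frac1{28}$. 3. Consequently,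 for $\frac1{28}<\lambda\le\frac1{26}$, $\mathcal N_\lambda$ is a norm, and $X_\lambda$ is a Banach space which is isometric to a subspace of $L_{1/4}$ but does not embed isometrically in $L_{1/2}$. -/

import Mathlib

open MeasureTheory
open scoped ENNReal

/-- `N` is a norm on the real vector space `V`. -/
structure IsNorm {V : Type*} [AddCommGroup V] [Module ℝ V] (N : V → ℝ) : Prop where
  nonneg : ∀ x, 0 ≤ N x
  add_le : ∀ x y, N (x + y) ≤ N x + N y
  smul : ∀ (c : ℝ) (x : V), N (c • x) = |c| * N x
  eq_zero : ∀ x, N x = 0 → x = 0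

/-- The norm `N`, bundled. -/
def IsNorm.addGroupNorm {V : Type*} [AddCommGroup V] [Module ℝ V] {N : V → ℝ}
    (hN : IsNorm N) : AddGroupNorm V where
  toFun := N
  map_zero' := by simpa using hN.smul 0 0
  add_le' := hN.add_le
  neg' x := by simpa using hN.smul (-1) x
  eq_zero_of_map_eq_zero' := hN.eq_zero

/-- The vector space `V` equipped with the norm `N` (and with no other norm or topology). -/
def NormedBy {V : Type*} [AddCommGroup V] [Module ℝ V] (N : V → ℝ) (_hN : IsNorm N) : Type _ := V

namespace NormedBy

variable {V : Type*} [AddCommGroup V] [Module ℝ V] (N : V → ℝ) (hN : IsNorm N)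

instance : AddCommGroup (NormedBy N hN) := inferInstanceAs (AddCommGroup V)

instance : Module ℝ (NormedBy N hN) := inferInstanceAs (Module ℝ V)

instance : NormedAddCommGroup (NormedBy N hN) :=
  AddGroupNorm.toNormedAddCommGroup (E := NormedBy N hN) hN.addGroupNorm

instance : NormedSpace ℝ (NormedBy N hN) where
  norm_smul_le c x := (hN.smul c x).le

end NormedBy

/-- The real normed space `X` is (linearly) isometric to a subspace of `L_q = L_q([0,1])`.
For `0 < q < ∞` the quantity `‖f‖` of `f : Lp ℝ q μ` is `(∫ |f| ^ q) ^ (1 / q)`, a quasi-norm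
if `q < 1`. -/
def EmbedsIsometricallyInL (X : Type*) [NormedAddCommGroup X] [NormedSpace ℝ X] (q : ℝ≥0∞) :
    Prop :=
  ∃ T : X →ₗ[ℝ] Lp ℝ q (volume.restrict (Set.Icc (0 : ℝ) 1)), ∀ x : X, ‖T x‖ = ‖x‖

/-- The Euclidean norm on `ℝ³` perturbed by a zonal function; its value at the origin is `0`. -/
noncomputable def perturbedNorm (lam : ℝ) (x : Fin 3 → ℝ) : ℝ :=
  Real.sqrt (x 0 ^ 2 + x 1 ^ 2 + x 2 ^ 2) *
    (1 + lam * ((x 0 ^ 2 + x 1 ^ 2 - 2 * x 2 ^ 2) / (x 0 ^ 2 + x 1 ^ 2 + x 2 ^ 2))) ^ 4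

/-! Norm criterion. With `v = x₁² + x₂²` and `c = x₃²` the function is `(α v + β c)⁴ / (v +
c)^(7/2)`, `α = 1 + λ`, `β = 1 - 2λ`. It is homogeneous of degree one in the radius and the height,
so on a meridian half-plane the triangle inequality amounts to convexity of a function of one
variable, whose second derivative is nonnegative when `λ ≤ 1/23`. Monotonicity in the radius and in
the height carries the inequality to `ℝ³`. Conversely, adding two equatorially symmetric vectors
near the equator forces `7 α ≤ 8 β`, which is `λ ≤ 1/23`.

Embeddings. A norm `N` embeds in `L_q` exactly when `N^q` is the `q`-cosine transform `∫ |⟨x, y⟩|^q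
dμ(y)` of a finite positive measure with finite `q`-th moment. The fourth power in the norm makes
`N^q / ‖x‖^q` a polynomial in `t² = (x₃ / ‖x‖)²`, of degree one for `q = 1/4` and two for `q = 1/2`.
Hence `N^q` is the transform of an explicit polynomial weight `w` against the standard Gaussian. If
`w ≥ 0` there is an embedding.

If `w` is negative at the pole `u = e₃`, no positive `μ` can exist. Testing two representations of
`N^q` against the Hermite polynomials `H_{2n}(⟨u, x⟩)` shows, by Funk–Hecke, that the moments of
`‖y‖^q cos^{2n}∠(u, y)` against `w` and `μ` agree up to a positive constant, so those of `w` are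
nonnegative. As `n → ∞` they concentrate at `±u`, which forces `w(u) ≥ 0`. The polar values are `1 -
26λ` for `q = 1/4` and `1 - 28λ - 44λ²` for `q = 1/2`. -/

/-! ### The norm criterion -/

/-- A zonal perturbation of the Euclidean norm, as a function of the squared distance `v` to the
axis and of the squared height `c`. -/
noncomputable def zonalProfile (α β v c : ℝ) : ℝ := (α * v + β * c) ^ 4 / √(v + c) ^ 7

lemma perturbedNorm_eq_zonalProfile (lam : ℝ) (x : Fin 3 → ℝ) :
    perturbedNorm lam x =
      zonalProfile (1 + lam) (1 - 2 * lam) (x 0 ^ 2 + x 1 ^ 2) (x 2 ^ 2) := by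
  unfold perturbedNorm zonalProfile
  rcases (by positivity : 0 ≤ x 0 ^ 2 + x 1 ^ 2 + x 2 ^ 2).eq_or_lt with h | h
  · simp [← h]
  · have hs : 0 < √(x 0 ^ 2 + x 1 ^ 2 + x 2 ^ 2) := Real.sqrt_pos.2 h
    have hs2 := Real.sq_sqrt h.le
    set s := √(x 0 ^ 2 + x 1 ^ 2 + x 2 ^ 2)
    rw [← hs2]
    field_simp
    rw [hs2]
    ring

namespace zonalProfile

lemma comm (α β v c : ℝ) : zonalProfile α β v c = zonalProfile β α c v := by
  simp only [zonalProfile, add_comm]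

lemma nonneg (α β v c : ℝ) : 0 ≤ zonalProfile α β v c := by
  unfold zonalProfile; positivity

lemma mul_sq (α β v c : ℝ) {a : ℝ} (ha : 0 ≤ a) :
    zonalProfile α β (a ^ 2 * v) (a ^ 2 * c) = a * zonalProfile α β v c := by
  unfold zonalProfile
  rw [← mul_add, Real.sqrt_mul (sq_nonneg a), Real.sqrt_sq ha]
  rcases ha.eq_or_lt with rfl | ha
  · simp
  · rw [show (α * (a ^ 2 * v) + β * (a ^ 2 * c)) ^ 4 = a ^ 7 * (a * (α * v + β * c) ^ 4) by ring,
      mul_pow, mul_div_mul_left _ _ (by positivity), mul_div_assoc]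

/-- Bernoulli's inequality for the exponent `7/8`, raised to the eighth power: the difference
expands with nonnegative coefficients. -/
lemma pow_seven_le_pow_eight {a : ℝ} (ha : 0 ≤ a) : (1 + a) ^ 7 ≤ (1 + 7 * a / 8) ^ 8 := by
  have h : 0 ≤ (1 + 7 * a / 8) ^ 8 - (1 + a) ^ 7 := by
    ring_nf
    positivity
  linarith

/-- The logarithmic derivative in `v` has the sign of `8α(v + c) - 7(αv + βc)`. The Bernoulli bound,
applied to the relative increment `(v' - v) / (v + c)`, stands in for differentiation. -/
lemma mono_left {α β v v' c : ℝ} (hα : 0 < α) (hβ : 0 < β) (h : 7 * β ≤ 8 * α) (hc : 0 ≤ c)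
    (hv : 0 ≤ v) (hvv : v ≤ v') : zonalProfile α β v c ≤ zonalProfile α β v' c := by
  rcases (add_nonneg hv hc).eq_or_lt with h0 | h0
  · have hc0 : c = 0 := by linarith
    have hv0 : v = 0 := by linarith
    subst hc0 hv0
    simpa [zonalProfile] using nonneg α β v' 0
  have h1 : 0 < v' + c := by linarith
  have hd : 0 ≤ v' - v := by linarith
  have hU : 0 < α * v + β * c := by
    rcases hv.eq_or_lt with rfl | hv
    · have : 0 < c := by linarith
      positivity
    · positivity
  have key : (α * v + β * c) ^ 8 * (v' + c) ^ 7 ≤ (α * v' + β * c) ^ 8 * (v + c) ^ 7 := by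
    have e1 : v' + c = (v + c) * (1 + (v' - v) / (v + c)) := by field_simp; ring
    have e2 : (α * v + β * c) * (1 + 7 * ((v' - v) / (v + c)) / 8) ≤ α * v' + β * c := by
      have : (α * v + β * c) * (7 * ((v' - v) / (v + c)) / 8) ≤ α * (v' - v) := by
        rw [show (α * v + β * c) * (7 * ((v' - v) / (v + c)) / 8) =
          (7 * (α * v + β * c) / 8) * (v' - v) / (v + c) by ring, div_le_iff₀ h0]
        have : 7 * (α * v + β * c) / 8 ≤ α * (v + c) := by nlinarith
        nlinarith
      nlinarith
    calc (α * v + β * c) ^ 8 * (v' + c) ^ 7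
        = (α * v + β * c) ^ 8 * (v + c) ^ 7 * (1 + (v' - v) / (v + c)) ^ 7 := by
          rw [e1, mul_pow, mul_assoc]
      _ ≤ (α * v + β * c) ^ 8 * (v + c) ^ 7 * (1 + 7 * ((v' - v) / (v + c)) / 8) ^ 8 := by
          gcongr
          exact pow_seven_le_pow_eight (by positivity)
      _ = ((α * v + β * c) * (1 + 7 * ((v' - v) / (v + c)) / 8)) ^ 8 * (v + c) ^ 7 := by ring
      _ ≤ _ := by gcongr
  unfold zonalProfile
  rw [div_le_div_iff₀ (by positivity) (by positivity)]
  refine le_of_sq_le_sq ?_ (by positivity)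
  have s1 := Real.sq_sqrt h0.le
  have s2 := Real.sq_sqrt h1.le
  calc _ = (α * v + β * c) ^ 8 * (√(v' + c) ^ 2) ^ 7 := by ring
    _ ≤ (α * v' + β * c) ^ 8 * (√(v + c) ^ 2) ^ 7 := by rwa [s1, s2]
    _ = _ := by ring

lemma mono_right {α β v c c' : ℝ} (hα : 0 < α) (hβ : 0 < β) (h : 7 * α ≤ 8 * β) (hv : 0 ≤ v)
    (hc : 0 ≤ c) (hcc : c ≤ c') : zonalProfile α β v c ≤ zonalProfile α β v c' := by
  rw [comm α, comm α]
  exact mono_left hβ hα h hv hc hcc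

lemma convexOn_sq_one {lam : ℝ} (h0 : 0 < lam) (h1 : lam ≤ 1 / 23) :
    ConvexOn ℝ Set.univ (fun r : ℝ ↦ zonalProfile (1 + lam) (1 - 2 * lam) (r ^ 2) 1) := by
  set A := 1 + lam with hA
  set B := 1 - 2 * lam with hB
  -- This is `8 * A - 7 * B`, which appears in the first derivative. In the second derivative only
  -- the coefficient with `1 - 23 * lam` can change sign near the bound.
  set C := 1 + 22 * lam with hC
  have hs (r : ℝ) : 0 < √(r ^ 2 + 1) := Real.sqrt_pos.2 (by positivity)
  have hs2 (r : ℝ) : √(r ^ 2 + 1) ^ 2 = r ^ 2 + 1 := Real.sq_sqrt (by positivity)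
  have hds (r : ℝ) : HasDerivAt (fun r : ℝ ↦ √(r ^ 2 + 1)) (r / √(r ^ 2 + 1)) r := by
    have := (((hasDerivAt_id r).pow 2).add_const 1).sqrt (by simp; positivity)
    convert! this using 1
    simp only [id, Pi.pow_apply]
    field_simp
    simp [mul_comm]
  have hdU (a b r : ℝ) : HasDerivAt (fun r : ℝ ↦ a * r ^ 2 + b) (2 * a * r) r := by
    have := (((hasDerivAt_id r).pow 2).const_mul a).add_const b
    convert! this using 1
    simp; ring
  have hd1 (r : ℝ) : HasDerivAt (fun r : ℝ ↦ zonalProfile A B (r ^ 2) 1)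
      (r * (A * r ^ 2 + B) ^ 3 * (A * r ^ 2 + C) / √(r ^ 2 + 1) ^ 9) r := by
    have := ((hdU A B r).pow 4).div ((hds r).pow 7) (pow_pos (hs r) 7).ne'
    have e : (fun r : ℝ ↦ zonalProfile A B (r ^ 2) 1) =
        (fun r : ℝ ↦ A * r ^ 2 + B) ^ 4 / (fun r : ℝ ↦ √(r ^ 2 + 1)) ^ 7 := by
      ext r; simp [zonalProfile]
    rw [e]
    convert! this using 1
    simp only [Pi.pow_apply]
    have := hs r
    have h2 := hs2 r
    set s := √(r ^ 2 + 1)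
    have h2' : r ^ 2 = s ^ 2 - 1 := by linarith
    rw [div_eq_div_iff (by positivity) (by positivity)]
    push_cast
    field_simp
    rw [h2']
    ring
  have hd2 (r : ℝ) : HasDerivAt
      (fun r : ℝ ↦ r * (A * r ^ 2 + B) ^ 3 * (A * r ^ 2 + C) / √(r ^ 2 + 1) ^ 9)
      ((A * r ^ 2 + B) ^ 2 * (A * (1 - 23 * lam) * r ^ 4 +
        (2 - 2 * lam + 500 * lam ^ 2) * r ^ 2 + B * C) / √(r ^ 2 + 1) ^ 11) r := by
    have := (((hasDerivAt_id r).mul ((hdU A B r).pow 3)).mul (hdU A C r)).div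
      ((hds r).pow 9) (pow_pos (hs r) 9).ne'
    convert! this using 1
    simp only [Pi.pow_apply, Pi.mul_apply, id]
    have := hs r
    have h2 := hs2 r
    set s := √(r ^ 2 + 1)
    rw [div_eq_div_iff (by positivity) (by positivity)]
    push_cast
    field_simp
    rw [hA, hB, hC, h2]
    ring
  refine convexOn_of_hasDerivWithinAt2_nonneg convex_univ ?_ (fun r _ ↦ (hd1 r).hasDerivWithinAt)
    (fun r _ ↦ (hd2 r).hasDerivWithinAt) ?_
  · exact fun r _ ↦ (hd1 r).continuousAt.continuousWithinAt
  · intro r _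
    have : 0 < A := by linarith
    have : 0 < B := by linarith
    have : 0 < C := by linarith
    have : 0 ≤ 1 - 23 * lam := by linarith
    have : 0 ≤ 2 - 2 * lam + 500 * lam ^ 2 := by nlinarith
    positivity

/-- For positive height the profile is the perspective `a * g (r / a)` of the convex function `g`
above, and perspectives of convex functions are subadditive. -/
lemma add_le_of_pos {lam : ℝ} (h0 : 0 < lam) (h1 : lam ≤ 1 / 23) (r r' : ℝ) {a a' : ℝ}
    (ha : 0 < a) (ha' : 0 < a') :
    zonalProfile (1 + lam) (1 - 2 * lam) ((r + r') ^ 2) ((a + a') ^ 2) ≤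
      zonalProfile (1 + lam) (1 - 2 * lam) (r ^ 2) (a ^ 2) +
      zonalProfile (1 + lam) (1 - 2 * lam) (r' ^ 2) (a' ^ 2) := by
  have hom (r : ℝ) {a : ℝ} (ha : 0 < a) : zonalProfile (1 + lam) (1 - 2 * lam) (r ^ 2) (a ^ 2) =
      a * zonalProfile (1 + lam) (1 - 2 * lam) ((r / a) ^ 2) 1 := by
    rw [← mul_sq _ _ _ _ ha.le]
    congr 1 <;> field_simp
  rw [hom _ ha, hom _ ha', hom _ (add_pos ha ha')]
  have hc := (convexOn_sq_one h0 h1).2 (Set.mem_univ (r / a)) (Set.mem_univ (r' / a'))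
    (show 0 ≤ a / (a + a') by positivity) (show 0 ≤ a' / (a + a') by positivity) (by field_simp)
  simp only [smul_eq_mul] at hc
  have e : a / (a + a') * (r / a) + a' / (a + a') * (r' / a') = (r + r') / (a + a') := by
    field_simp
  rw [e] at hc
  calc _ ≤ (a + a') * _ := mul_le_mul_of_nonneg_left hc (by positivity)
    _ = _ := by field_simp

/-- Both heights are raised by `e > 0` and `e` tends to `0`. Monotonicity in the height absorbs the
extra `2e` on the left, so only the right side needs a limit; the quotient is visibly continuous
away from the origin, hence the two degenerate cases. -/
lemma add_le {lam : ℝ} (h0 : 0 < lam) (h1 : lam ≤ 1 / 23) {r r' a a' : ℝ}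
    (hr : 0 ≤ r) (hr' : 0 ≤ r') (ha : 0 ≤ a) (ha' : 0 ≤ a') :
    zonalProfile (1 + lam) (1 - 2 * lam) ((r + r') ^ 2) ((a + a') ^ 2) ≤
      zonalProfile (1 + lam) (1 - 2 * lam) (r ^ 2) (a ^ 2) +
      zonalProfile (1 + lam) (1 - 2 * lam) (r' ^ 2) (a' ^ 2) := by
  have tend {r a : ℝ} (h : r ^ 2 + a ^ 2 ≠ 0) : Filter.Tendsto
      (fun e : ℝ ↦ zonalProfile (1 + lam) (1 - 2 * lam) (r ^ 2) ((a + e) ^ 2))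
      (nhdsWithin 0 (Set.Ioi 0)) (nhds (zonalProfile (1 + lam) (1 - 2 * lam) (r ^ 2) (a ^ 2))) := by
    have : ContinuousAt
        (fun e : ℝ ↦ zonalProfile (1 + lam) (1 - 2 * lam) (r ^ 2) ((a + e) ^ 2)) 0 := by
      unfold zonalProfile
      refine ContinuousAt.div (by fun_prop) (by fun_prop) ?_
      have : 0 < r ^ 2 + (a + 0) ^ 2 := lt_of_le_of_ne (by positivity) (by simpa using h.symm)
      positivity
    simpa using this.tendsto.mono_left nhdsWithin_le_nhds
  by_cases h : r ^ 2 + a ^ 2 = 0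
  · obtain rfl : r = 0 := by nlinarith
    obtain rfl : a = 0 := by nlinarith
    simp [zonalProfile]
  by_cases h' : r' ^ 2 + a' ^ 2 = 0
  · obtain rfl : r' = 0 := by nlinarith
    obtain rfl : a' = 0 := by nlinarith
    simp [zonalProfile]
  refine ge_of_tendsto ((tend h).add (tend h')) ?_
  filter_upwards [self_mem_nhdsWithin] with e he
  have he : 0 < e := he
  refine le_trans (mono_right (by linarith) (by linarith) (by linarith) (sq_nonneg _) (sq_nonneg _)
    ?_) (add_le_of_pos h0 h1 r r' (a := a + e) (a' := a' + e) (by linarith) (by linarith))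
  gcongr <;> linarith

end zonalProfile

theorem isNorm_perturbedNorm {lam : ℝ} (h0 : 0 < lam) (h1 : lam ≤ 1 / 23) :
    IsNorm (perturbedNorm lam) where
  nonneg x := by
    rw [perturbedNorm_eq_zonalProfile]
    exact zonalProfile.nonneg _ _ _ _
  smul c x := by
    simp only [perturbedNorm_eq_zonalProfile, Pi.smul_apply, smul_eq_mul]
    rw [← zonalProfile.mul_sq _ _ _ _ (abs_nonneg c), sq_abs]
    congr 1 <;> ring
  eq_zero x hx := by
    rw [perturbedNorm_eq_zonalProfile, zonalProfile, div_eq_zero_iff, pow_eq_zero_iff (by simp),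
      pow_eq_zero_iff (by simp)] at hx
    have hx : x 0 ^ 2 + x 1 ^ 2 + x 2 ^ 2 ≤ 0 := by
      rcases hx with hx | hx
      · nlinarith [sq_nonneg (x 0), sq_nonneg (x 1), sq_nonneg (x 2)]
      · rwa [Real.sqrt_eq_zero'] at hx
    ext i
    fin_cases i <;> simp <;> nlinarith [sq_nonneg (x 0), sq_nonneg (x 1), sq_nonneg (x 2)]
  add_le x y := by
    simp only [perturbedNorm_eq_zonalProfile, Pi.add_apply]
    have hA : 0 < 1 + lam := by linarith
    have hB : 0 < 1 - 2 * lam := by linarith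
    have hx : (√(x 0 ^ 2 + x 1 ^ 2)) ^ 2 = x 0 ^ 2 + x 1 ^ 2 := Real.sq_sqrt (by positivity)
    have hy : (√(y 0 ^ 2 + y 1 ^ 2)) ^ 2 = y 0 ^ 2 + y 1 ^ 2 := Real.sq_sqrt (by positivity)
    have hxy : (x 0 + y 0) ^ 2 + (x 1 + y 1) ^ 2 ≤
        (√(x 0 ^ 2 + x 1 ^ 2) + √(y 0 ^ 2 + y 1 ^ 2)) ^ 2 := by
      have : x 0 * y 0 + x 1 * y 1 ≤ √(x 0 ^ 2 + x 1 ^ 2) * √(y 0 ^ 2 + y 1 ^ 2) := by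
        rw [← Real.sqrt_mul (by positivity)]
        refine Real.le_sqrt_of_sq_le ?_
        nlinarith [sq_nonneg (x 0 * y 1 - x 1 * y 0)]
      nlinarith
    have hz : (x 2 + y 2) ^ 2 ≤ (|x 2| + |y 2|) ^ 2 := by
      rw [← sq_abs (x 2 + y 2)]
      gcongr
      exact abs_add_le _ _
    calc _ ≤ zonalProfile (1 + lam) (1 - 2 * lam)
          ((√(x 0 ^ 2 + x 1 ^ 2) + √(y 0 ^ 2 + y 1 ^ 2)) ^ 2) ((x 2 + y 2) ^ 2) :=
          zonalProfile.mono_left hA hB (by linarith) (sq_nonneg _) (by positivity) hxy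
      _ ≤ zonalProfile (1 + lam) (1 - 2 * lam)
          ((√(x 0 ^ 2 + x 1 ^ 2) + √(y 0 ^ 2 + y 1 ^ 2)) ^ 2) ((|x 2| + |y 2|) ^ 2) :=
          zonalProfile.mono_right hA hB (by linarith) (sq_nonneg _) (by positivity) hz
      _ ≤ _ := by
          refine (zonalProfile.add_le h0 h1 (by positivity) (by positivity) (by positivity)
            (by positivity)).trans_eq ?_
          rw [hx, hy, sq_abs, sq_abs]

theorem le_of_isNorm_perturbedNorm {lam : ℝ} (h0 : 0 < lam) (hN : IsNorm (perturbedNorm lam)) :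
    lam ≤ 1 / 23 := by
  set A := 1 + lam with hA
  set B := 1 - 2 * lam with hB
  have hpoly (v : ℝ) (hv : 0 ≤ v) : A ^ 8 * (1 + v) ^ 7 ≤ (A + B * v) ^ 8 := by
    -- The vectors are mirror images in the equatorial plane with sum `(2, 0, 0)`, so `N(1, 0, 0) ≤
    -- N(1, 0, √v)`; squaring removes the root.
    have h := hN.add_le ![1, 0, √v] ![1, 0, -√v]
    simp only [perturbedNorm_eq_zonalProfile, Pi.add_apply] at h
    have e (t : ℝ) : ![1, 0, t] (2 : Fin 3) = t := rfl
    norm_num [zonalProfile, e] at h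
    rw [Real.sq_sqrt hv] at h
    have h' : A ^ 4 ≤ (A + B * v) ^ 4 / √(1 + v) ^ 7 := by
      simp only [hA, hB]; nlinarith
    rw [le_div_iff₀ (by positivity)] at h'
    have hs := Real.sq_sqrt (by positivity : 0 ≤ 1 + v)
    calc _ = (A ^ 4 * √(1 + v) ^ 7) ^ 2 := by rw [← hs]; simp; ring
      _ ≤ ((A + B * v) ^ 4) ^ 2 := by gcongr
      _ = _ := by ring
  -- Equality holds at `v = 0`, so the right derivative there is nonnegative, which gives `7 * A ≤ 8
  -- * B`.
  have hd : HasDerivAt (fun v : ℝ ↦ (A + B * v) ^ 8 - A ^ 8 * (1 + v) ^ 7)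
      (8 * A ^ 7 * B - A ^ 8 * 7) 0 := by
    have h1 := ((((hasDerivAt_id (0 : ℝ)).const_mul B).const_add A).pow 8).sub
      ((((hasDerivAt_id (0 : ℝ)).const_add 1).pow 7).const_mul (A ^ 8))
    convert! h1 using 1
    simp
  have hge : 0 ≤ 8 * A ^ 7 * B - A ^ 8 * 7 := by
    refine ge_of_tendsto (hasDerivWithinAt_iff_tendsto_slope' (s := Set.Ioi 0) (by simp) |>.1
      hd.hasDerivWithinAt) ?_
    filter_upwards [self_mem_nhdsWithin] with v hv
    have hv : 0 < v := hv
    have := hpoly v hv.le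
    rw [slope_def_field]
    refine div_nonneg ?_ (by linarith)
    simp
    linarith
  have hA7 : 0 < A ^ 7 := by positivity
  have : 0 ≤ A ^ 7 * (8 * B - 7 * A) := by linarith [hge]
  have := nonneg_of_mul_nonneg_right this hA7
  simp only [hA, hB] at this
  linarith

theorem isNorm_perturbedNorm_iff {lam : ℝ} (h0 : 0 < lam) :
    IsNorm (perturbedNorm lam) ↔ lam ≤ 1 / 23 :=
  ⟨le_of_isNorm_perturbedNorm h0, isNorm_perturbedNorm h0⟩

/-! ### Hermite polynomials, Stein's identity and moments of `|z| ^ q` -/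

section HermiteMoments

open ProbabilityTheory Polynomial

namespace Polynomial

theorem derivative_hermite_succ (n : ℕ) :
    derivative (hermite (n + 1)) = (n + 1 : ℤ[X]) * hermite n := by
  induction n with
  | zero => simp
  | succ n ih =>
    rw [hermite_succ (n + 1), derivative_sub, derivative_mul, ih, derivative_mul, hermite_succ n]
    simp
    ring

theorem hermite_succ_succ (n : ℕ) :
    hermite (n + 2) = X * hermite (n + 1) - (n + 1 : ℤ[X]) * hermite n := by
  rw [hermite_succ (n + 1), derivative_hermite_succ]

theorem aeval_hermite_succ_succ (n : ℕ) (x : ℝ) :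
    aeval x (hermite (n + 2)) =
      x * aeval x (hermite (n + 1)) - (n + 1) * aeval x (hermite n) := by
  rw [hermite_succ_succ]
  simp

theorem hasDerivAt_aeval_hermite_succ (n : ℕ) (x : ℝ) :
    HasDerivAt (fun x : ℝ ↦ aeval x (hermite (n + 1))) ((n + 1) * aeval x (hermite n)) x := by
  have := (hermite (n + 1)).hasDerivAt_aeval x
  rw [derivative_hermite_succ] at this
  simpa using this

end Polynomial

/-- `f` is measurable and grows at most polynomially. -/
def HasPolyGrowth {E : Type*} [NormedAddCommGroup E] [MeasurableSpace E] (f : E → ℝ) : Prop :=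
  Measurable f ∧ ∃ (C : ℝ) (k : ℕ), 0 ≤ C ∧ ∀ x, |f x| ≤ C * (1 + ‖x‖) ^ k

namespace HasPolyGrowth

variable {E : Type*} [NormedAddCommGroup E] [MeasurableSpace E] {f g : E → ℝ}

lemma const (c : ℝ) : HasPolyGrowth (fun _ : E ↦ c) :=
  ⟨measurable_const, |c|, 0, abs_nonneg c, by simp⟩

lemma add (hf : HasPolyGrowth f) (hg : HasPolyGrowth g) :
    HasPolyGrowth (fun x ↦ f x + g x) := by
  obtain ⟨hfm, C, k, hC, hf⟩ := hf
  obtain ⟨hgm, D, l, hD, hg⟩ := hg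
  refine ⟨hfm.add hgm, C + D, k + l, by positivity, fun x ↦ ?_⟩
  have h1 : (1 : ℝ) ≤ 1 + ‖x‖ := by linarith [norm_nonneg x]
  calc |f x + g x| ≤ |f x| + |g x| := abs_add_le _ _
    _ ≤ C * (1 + ‖x‖) ^ k + D * (1 + ‖x‖) ^ l := add_le_add (hf x) (hg x)
    _ ≤ C * (1 + ‖x‖) ^ (k + l) + D * (1 + ‖x‖) ^ (k + l) := by
        gcongr <;> first | exact h1 | simp
    _ = _ := by ring

lemma mul (hf : HasPolyGrowth f) (hg : HasPolyGrowth g) :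
    HasPolyGrowth (fun x ↦ f x * g x) := by
  obtain ⟨hfm, C, k, hC, hf⟩ := hf
  obtain ⟨hgm, D, l, hD, hg⟩ := hg
  refine ⟨hfm.mul hgm, C * D, k + l, by positivity, fun x ↦ ?_⟩
  rw [abs_mul, pow_add, mul_mul_mul_comm]
  exact mul_le_mul (hf x) (hg x) (abs_nonneg _) (by positivity)

lemma const_mul (c : ℝ) (hf : HasPolyGrowth f) : HasPolyGrowth (fun x ↦ c * f x) :=
  (const c).mul hf

lemma sub (hf : HasPolyGrowth f) (hg : HasPolyGrowth g) :
    HasPolyGrowth (fun x ↦ f x - g x) := by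
  simpa [sub_eq_add_neg] using hf.add (hg.const_mul (-1))

lemma pow (hf : HasPolyGrowth f) (n : ℕ) : HasPolyGrowth (fun x ↦ f x ^ n) := by
  induction n with
  | zero => simpa using const 1
  | succ n ih => simpa [pow_succ] using ih.mul hf

lemma mono (hf : HasPolyGrowth f) (hg : Measurable g) (h : ∀ x, |g x| ≤ |f x|) :
    HasPolyGrowth g := by
  obtain ⟨-, C, k, hC, hf⟩ := hf
  exact ⟨hg, C, k, hC, fun x ↦ (h x).trans (hf x)⟩

lemma aeval (hf : HasPolyGrowth f) (p : ℤ[X]) :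
    HasPolyGrowth (fun x ↦ Polynomial.aeval (f x) p) := by
  induction p using Polynomial.induction_on' with
  | add p q hp hq => simpa using hp.add hq
  | monomial n a => simpa using (hf.pow n).const_mul a

lemma norm [OpensMeasurableSpace E] : HasPolyGrowth (fun x : E ↦ ‖x‖) :=
  ⟨measurable_norm, 1, 1, by simp, by simp⟩

lemma abs (hf : HasPolyGrowth f) : HasPolyGrowth (fun x ↦ |f x|) :=
  hf.mono (by have := hf.1; fun_prop) (by simp)

lemma abs_rpow (hf : HasPolyGrowth f) {q : ℝ} (hq : 0 ≤ q) (hq1 : q ≤ 1) :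
    HasPolyGrowth (fun x ↦ |f x| ^ q) := by
  refine ((const 1).add hf.abs).mono (by have := hf.1; fun_prop) fun x ↦ ?_
  have e1 : |(|f x| ^ q)| = |f x| ^ q := abs_of_nonneg (by positivity)
  have e2 : |(1 + |f x|)| = 1 + |f x| := abs_of_nonneg (by positivity)
  rw [e1, e2]
  rcases le_total |f x| 1 with h | h
  · linarith [Real.rpow_le_one (abs_nonneg (f x)) h hq, abs_nonneg (f x)]
  · have := Real.rpow_le_rpow_of_exponent_le h hq1
    rw [Real.rpow_one] at this
    linarith

lemma norm_rpow [OpensMeasurableSpace E] {q : ℝ} (hq : 0 ≤ q) (hq1 : q ≤ 1) :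
    HasPolyGrowth (fun x : E ↦ ‖x‖ ^ q) := by
  simpa using (norm (E := E)).abs_rpow hq hq1

lemma clm [NormedSpace ℝ E] [OpensMeasurableSpace E] (L : E →L[ℝ] ℝ) :
    HasPolyGrowth (fun x ↦ L x) := by
  refine ⟨by fun_prop, ‖L‖, 1, norm_nonneg _, fun x ↦ ?_⟩
  have := L.le_opNorm x
  rw [Real.norm_eq_abs] at this
  nlinarith [norm_nonneg L]

lemma id_real : HasPolyGrowth (fun x : ℝ ↦ x) := clm (ContinuousLinearMap.id ℝ ℝ)

lemma inner_left {E : Type*} [NormedAddCommGroup E] [MeasurableSpace E] [InnerProductSpace ℝ E]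
    [OpensMeasurableSpace E] (a : E) : HasPolyGrowth (fun x ↦ inner ℝ a x) := clm (innerSL ℝ a)

/-- A Gaussian measure has moments of all orders. Together with the closure properties above, this
settles the integrability conditions below. -/
lemma integrable [NormedSpace ℝ E] [BorelSpace E] [SecondCountableTopology E] [CompleteSpace E]
    (hf : HasPolyGrowth f) (μ : Measure E) [IsGaussian μ] : Integrable f μ := by
  obtain ⟨hfm, C, k, hC, hf⟩ := hf
  have h0 : MemLp (fun x : E ↦ ‖x‖) k μ := (IsGaussian.memLp_id μ k (by simp)).norm
  have h1 : MemLp (fun x : E ↦ 1 + ‖x‖) k μ := (memLp_const (1 : ℝ)).add h0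
  refine ((h1.integrable_norm_pow').const_mul C).mono' hfm.aestronglyMeasurable (ae_of_all _ ?_)
  intro x
  rw [Real.norm_eq_abs, Real.norm_eq_abs, abs_of_nonneg (by positivity : 0 ≤ 1 + ‖x‖)]
  exact hf x

end HasPolyGrowth

/-- Stein's identity: Gaussian integration by parts. -/
lemma integral_mul_gaussianReal_eq_integral_deriv {f f' : ℝ → ℝ}
    (hf : ∀ x, HasDerivAt f (f' x) x) (h : HasPolyGrowth f) (h' : HasPolyGrowth f') :
    ∫ x, x * f x ∂gaussianReal 0 1 = ∫ x, f' x ∂gaussianReal 0 1 := by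
  have toVol {g : ℝ → ℝ} (hg : HasPolyGrowth g) :
      Integrable (fun x ↦ gaussianPDFReal 0 1 x * g x) := by
    have := hg.integrable (gaussianReal 0 1)
    rw [gaussianReal_of_var_ne_zero _ one_ne_zero,
      integrable_withDensity_iff_integrable_smul' (measurable_gaussianPDF 0 1)
        (ae_of_all _ fun _ ↦ gaussianPDF_lt_top)] at this
    simpa [toReal_gaussianPDF] using this
  have hpdf (x : ℝ) : HasDerivAt (gaussianPDFReal 0 1) (-x * gaussianPDFReal 0 1 x) x := by
    unfold gaussianPDFReal
    have h1 : HasDerivAt (fun x : ℝ ↦ -(x - 0) ^ 2 / (2 * (1 : NNReal))) (-x) x := by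
      have := ((((hasDerivAt_id x).sub_const 0).pow 2).neg).div_const (2 * ((1 : NNReal) : ℝ))
      convert! this using 1
      simp; ring
    convert! (h1.exp).const_mul (√(2 * Real.pi * (1 : NNReal)))⁻¹ using 1
    ring
  have hx := HasPolyGrowth.id_real.mul h
  have key := integral_eq_zero_of_hasDerivAt_of_integrable (fun x ↦ (hpdf x).mul (hf x)) ?_
    (toVol h)
  · rw [← sub_eq_zero, ← integral_sub (hx.integrable _) (h'.integrable _),
      integral_gaussianReal_eq_integral_smul one_ne_zero, ← neg_eq_zero, ← integral_neg]
    refine Eq.trans (integral_congr_ae (ae_of_all _ fun x ↦ ?_)) key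
    simp only [smul_eq_mul]
    ring
  · refine ((toVol h').sub (toVol hx)).congr (ae_of_all _ fun x ↦ ?_)
    simp only [Pi.sub_apply]
    ring

/-- Hermite polynomials are eigenfunctions of the Ornstein–Uhlenbeck semigroup. In the three-term
recurrence Stein's identity trades the factor `w` for `s * (m + 1)` times a lower polynomial, and `t
^ 2 + s ^ 2 = 1` recombines the terms. -/
lemma integral_aeval_hermite_comp_affine {t s : ℝ} (h : t ^ 2 + s ^ 2 = 1) (z : ℝ) (m : ℕ) :
    ∫ w, aeval (t * z + s * w) (hermite m) ∂gaussianReal 0 1 = t ^ m * aeval z (hermite m) := by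
  have gr (m : ℕ) : HasPolyGrowth (fun w : ℝ ↦ aeval (t * z + s * w) (hermite m)) :=
    ((HasPolyGrowth.const (t * z)).add (HasPolyGrowth.id_real.const_mul s)).aeval _
  have hint (m : ℕ) := (gr m).integrable (gaussianReal 0 1)
  induction m using Nat.twoStepInduction with
  | zero => simp
  | one =>
    simp only [hermite_one, aeval_X, pow_one]
    rw [integral_add (integrable_const _) ((HasPolyGrowth.id_real.const_mul s).integrable _),
      integral_const, integral_const_mul, integral_id_gaussianReal]
    simp
  | more m ih ih1 =>
    have stein : ∫ w, w * aeval (t * z + s * w) (hermite (m + 1)) ∂gaussianReal 0 1 =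
        ∫ w, s * (m + 1) * aeval (t * z + s * w) (hermite m) ∂gaussianReal 0 1 := by
      refine integral_mul_gaussianReal_eq_integral_deriv (fun w ↦ ?_) (gr _) ((gr m).const_mul _)
      have h1 : HasDerivAt (fun w : ℝ ↦ t * z + s * w) s w := by
        simpa using ((hasDerivAt_id w).const_mul s).const_add (t * z)
      convert! (hasDerivAt_aeval_hermite_succ m (t * z + s * w)).comp w h1 using 1
      ring
    have e (w : ℝ) : aeval (t * z + s * w) (hermite (m + 2)) =
        (t * z) * aeval (t * z + s * w) (hermite (m + 1)) +
        s * (w * aeval (t * z + s * w) (hermite (m + 1))) -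
        (m + 1) * aeval (t * z + s * w) (hermite m) := by
      rw [aeval_hermite_succ_succ]; ring
    simp_rw [e]
    have i1 := (hint (m + 1)).const_mul (t * z)
    have i2 := ((HasPolyGrowth.id_real.mul (gr (m + 1))).integrable (gaussianReal 0 1)).const_mul s
    have i3 := (hint m).const_mul (m + 1 : ℝ)
    have i12 : Integrable (fun w ↦ t * z * aeval (t * z + s * w) (hermite (m + 1)) +
      s * (w * aeval (t * z + s * w) (hermite (m + 1)))) (gaussianReal 0 1) := i1.add i2
    rw [integral_sub i12 i3, integral_add i1 i2, integral_const_mul, integral_const_mul,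
      integral_const_mul, stein, integral_const_mul, ih, ih1, aeval_hermite_succ_succ]
    linear_combination (m + 1 : ℝ) * t ^ m * aeval z (hermite m) * h

/-- The moment of `|z| ^ q` against the `m`-th Hermite polynomial. -/
noncomputable def hermiteMoment (q : ℝ) (m : ℕ) : ℝ :=
  ∫ z, |z| ^ q * aeval z (hermite m) ∂gaussianReal 0 1

/-- The extra factor `x` makes the function differentiable at the origin too, so that Stein's
identity applies. -/
lemma hasDerivAt_abs_rpow_mul_self {q : ℝ} (hq : 0 < q) (x : ℝ) :
    HasDerivAt (fun x : ℝ ↦ |x| ^ q * x) ((q + 1) * |x| ^ q) x := by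
  rcases lt_trichotomy x 0 with hx | rfl | hx
  · have h1 := ((hasDerivAt_id x).neg.rpow_const (p := q) (Or.inl (by simpa using hx.ne))).mul
      (hasDerivAt_id x)
    have h2 : (fun x : ℝ ↦ |x| ^ q * x) =ᶠ[nhds x] fun x ↦ (-x) ^ q * x := by
      filter_upwards [Iio_mem_nhds hx] with y hy
      rw [abs_of_neg hy]
    refine (HasDerivAt.congr_of_eventuallyEq ?_ h2)
    convert! h1 using 1
    simp only [id, abs_of_neg hx, Pi.neg_apply, Real.rpow_sub_one (neg_pos.2 hx).ne']
    have := hx.ne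
    field_simp
  · rw [hasDerivAt_iff_tendsto_slope, abs_zero, Real.zero_rpow hq.ne', mul_zero]
    have : Filter.Tendsto (fun x : ℝ ↦ |x| ^ q) (nhdsWithin 0 {0}ᶜ) (nhds 0) := by
      have : Continuous (fun x : ℝ ↦ |x| ^ q) := continuous_abs.rpow_const fun _ ↦ Or.inr hq.le
      simpa [Real.zero_rpow hq.ne'] using (this.tendsto 0).mono_left nhdsWithin_le_nhds
    refine this.congr' ?_
    filter_upwards [self_mem_nhdsWithin] with y hy
    have hy : y ≠ 0 := hy
    simp [slope_def_field, hy]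
  · have h1 := ((hasDerivAt_id x).rpow_const (p := q) (Or.inl (by simpa using hx.ne'))).mul
      (hasDerivAt_id x)
    have h2 : (fun x : ℝ ↦ |x| ^ q * x) =ᶠ[nhds x] fun x ↦ x ^ q * x := by
      filter_upwards [Ioi_mem_nhds hx] with y hy
      rw [abs_of_pos hy]
    refine (HasDerivAt.congr_of_eventuallyEq ?_ h2)
    convert! h1 using 1
    simp only [id, abs_of_pos hx, Real.rpow_sub_one hx.ne']
    field_simp

/-- Apply the recurrence twice and Stein's identity to `|z| ^ q * z * H_{m-1}`; the terms with `z *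
H_{m-2}` cancel. The case `m = 0` has no lower polynomial and is done apart. -/
lemma hermiteMoment_add_two {q : ℝ} (hq : 0 < q) (hq1 : q ≤ 1) (m : ℕ) :
    hermiteMoment q (m + 2) = (q - m) * hermiteMoment q m := by
  have gq : HasPolyGrowth (fun z : ℝ ↦ |z| ^ q) := HasPolyGrowth.id_real.abs_rpow hq.le hq1
  have gh (m : ℕ) : HasPolyGrowth (fun z : ℝ ↦ aeval z (hermite m)) :=
    HasPolyGrowth.id_real.aeval _
  have gz := gq.mul HasPolyGrowth.id_real
  have stein (m : ℕ) : ∫ z, z * (|z| ^ q * z * aeval z (hermite (m + 1))) ∂gaussianReal 0 1 =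
      ∫ z, ((q + 1) * (|z| ^ q * aeval z (hermite (m + 1))) +
        (m + 1) * (|z| ^ q * z * aeval z (hermite m))) ∂gaussianReal 0 1 := by
    refine integral_mul_gaussianReal_eq_integral_deriv (fun z ↦ ?_) (gz.mul (gh _))
      (((gq.mul (gh _)).const_mul _).add ((gz.mul (gh _)).const_mul _))
    convert! (hasDerivAt_abs_rpow_mul_self hq z).mul (hasDerivAt_aeval_hermite_succ m z) using 1
    ring
  have I {f : ℝ → ℝ} (hf : HasPolyGrowth f) := hf.integrable (gaussianReal 0 1)
  unfold hermiteMoment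
  rcases m with _ | m
  · have stein0 : ∫ z, z * (|z| ^ q * z) ∂gaussianReal 0 1 =
        ∫ z, (q + 1) * |z| ^ q ∂gaussianReal 0 1 :=
      integral_mul_gaussianReal_eq_integral_deriv (hasDerivAt_abs_rpow_mul_self hq) gz
        (gq.const_mul _)
    have e (z : ℝ) : |z| ^ q * aeval z (hermite (0 + 2)) = z * (|z| ^ q * z) - |z| ^ q := by
      rw [aeval_hermite_succ_succ]; simp; ring
    simp_rw [e]
    rw [integral_sub (I (HasPolyGrowth.id_real.mul gz)) (I gq), stein0, integral_const_mul]
    simp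
    ring
  · have e (z : ℝ) : |z| ^ q * aeval z (hermite (m + 1 + 2)) =
        z * (|z| ^ q * z * aeval z (hermite (m + 1))) -
        (m + 1) * (|z| ^ q * z * aeval z (hermite m)) -
        (m + 2) * (|z| ^ q * aeval z (hermite (m + 1))) := by
      rw [aeval_hermite_succ_succ, aeval_hermite_succ_succ]; push_cast; ring
    simp_rw [e]
    have i1 := I (HasPolyGrowth.id_real.mul (gz.mul (gh (m + 1))))
    have i2 := I ((gz.mul (gh m)).const_mul (m + 1))
    have i3 := I (gq.mul (gh (m + 1)))
    have i12 : Integrable (fun z : ℝ ↦ z * (|z| ^ q * z * aeval z (hermite (m + 1))) -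
        (m + 1) * (|z| ^ q * z * aeval z (hermite m))) (gaussianReal 0 1) := i1.sub i2
    rw [integral_sub i12 (i3.const_mul _), integral_sub i1 i2, stein,
      integral_add (i3.const_mul _) i2, integral_const_mul, integral_const_mul,
      integral_const_mul]
    push_cast
    ring

lemma hermiteMoment_zero_pos {q : ℝ} (hq : 0 < q) (hq1 : q ≤ 1) : 0 < hermiteMoment q 0 := by
  have gq : HasPolyGrowth (fun z : ℝ ↦ |z| ^ q) := HasPolyGrowth.id_real.abs_rpow hq.le hq1
  simp only [hermiteMoment, hermite_zero, map_one, mul_one]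
  rw [integral_pos_iff_support_of_nonneg (fun z ↦ by positivity) (gq.integrable _)]
  have : Function.support (fun z : ℝ ↦ |z| ^ q) = {0}ᶜ := by
    ext z
    simp [hq.ne']
  have := nullSingletonClass_gaussianReal (μ := 0) (v := 1) one_ne_zero
  simp_all [prob_compl_eq_one_sub]

/-- The factors `q - 2n` of the recurrence never vanish for `0 < q < 1`. This injectivity is what
makes the duality argument work. -/
lemma hermiteMoment_two_mul_ne_zero {q : ℝ} (hq : 0 < q) (hq1 : q < 1) (n : ℕ) :
    hermiteMoment q (2 * n) ≠ 0 := by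
  induction n with
  | zero => exact (hermiteMoment_zero_pos hq hq1.le).ne'
  | succ n ih =>
    rw [show 2 * (n + 1) = 2 * n + 2 by ring, hermiteMoment_add_two hq hq1.le]
    refine mul_ne_zero ?_ ih
    rcases n with _ | n
    · simpa using hq.ne'
    · push_cast
      have : (0 : ℝ) ≤ n := n.cast_nonneg
      linarith

end HermiteMoments

/-! ### Funk–Hecke formula, duality and concentration at a pole -/

section GaussianFunkHecke

open ProbabilityTheory Polynomial

lemma exists_sq_add_sq_eq_one {E : Type*} [NormedAddCommGroup E]
    [InnerProductSpace ℝ E] {a u : E} (ha : ‖a‖ = 1) (hu : ‖u‖ = 1) :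
    ∃ s : ℝ, inner ℝ a u ^ 2 + s ^ 2 = 1 := by
  have : |inner ℝ a u| ≤ 1 := by simpa [ha, hu] using abs_real_inner_le_norm a u
  refine ⟨√(1 - inner ℝ a u ^ 2), ?_⟩
  rw [Real.sq_sqrt (by rw [sub_nonneg, sq_le_one_iff_abs_le_one]; exact this)]
  ring

variable {E : Type*} [NormedAddCommGroup E] [InnerProductSpace ℝ E] [FiniteDimensional ℝ E]
  [MeasurableSpace E] [BorelSpace E]

lemma charFunDual_gaussianReal_zero_one (L : ℝ →L[ℝ] ℝ) :
    charFunDual (gaussianReal 0 1) L = Complex.exp (-((L 1 : ℝ) : ℂ) ^ 2 / 2) := by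
  have : charFunDual (gaussianReal 0 1) L = charFun (gaussianReal 0 1) (L 1) := by
    rw [charFunDual_apply, charFun_apply_real]
    congr 1 with v
    rw [show L v = L 1 * v by simpa [mul_comm] using L.map_smul v 1]
    push_cast
    ring_nf
  rw [this, charFun_gaussianReal]
  congr 1
  simp
  ring

/-- The joint law of two normalized linear forms under the standard Gaussian measure. -/
lemma map_inner_prod_stdGaussian {a u : E} (ha : ‖a‖ = 1) (hu : ‖u‖ = 1) {s : ℝ}
    (hs : inner ℝ a u ^ 2 + s ^ 2 = 1) :
    (stdGaussian E).map (fun y ↦ (inner ℝ a y, inner ℝ u y)) =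
      ((gaussianReal 0 1).prod (gaussianReal 0 1)).map
        (fun p ↦ (p.1, inner ℝ a u * p.1 + s * p.2)) := by
  have m1 : (fun y : E ↦ (inner ℝ a y, inner ℝ u y)) = (innerSL ℝ a).prod (innerSL ℝ u) := by
    ext y <;> simp
  have m2 : (fun p : ℝ × ℝ ↦ (p.1, inner ℝ a u * p.1 + s * p.2)) =
      (ContinuousLinearMap.fst ℝ ℝ ℝ).prod
        (inner ℝ a u • ContinuousLinearMap.fst ℝ ℝ ℝ + s • ContinuousLinearMap.snd ℝ ℝ ℝ) := by
    ext p <;> simp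
  have i1 : IsProbabilityMeasure
      ((stdGaussian E).map ((innerSL ℝ a).prod (innerSL ℝ u))) :=
    Measure.isProbabilityMeasure_map (by fun_prop)
  rw [m1, m2]
  have i2 : IsProbabilityMeasure (((gaussianReal 0 1).prod (gaussianReal 0 1)).map
      ((ContinuousLinearMap.fst ℝ ℝ ℝ).prod
        (inner ℝ a u • ContinuousLinearMap.fst ℝ ℝ ℝ + s • ContinuousLinearMap.snd ℝ ℝ ℝ))) :=
    Measure.isProbabilityMeasure_map (by fun_prop)
  apply Measure.ext_of_charFunDual
  ext L
  rw [charFunDual_map, charFunDual_map, charFunDual_stdGaussian, charFunDual_prod,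
    charFunDual_gaussianReal_zero_one, charFunDual_gaussianReal_zero_one, ← Complex.exp_add]
  have hL (p : ℝ × ℝ) : L p = L (1, 0) * p.1 + L (0, 1) * p.2 := by
    conv_lhs => rw [show p = p.1 • ((1 : ℝ), (0 : ℝ)) + p.2 • ((0 : ℝ), (1 : ℝ)) by ext <;> simp]
    rw [map_add, map_smul, map_smul, smul_eq_mul, smul_eq_mul, mul_comm, mul_comm p.2]
  have e1 : L.comp ((innerSL ℝ a).prod (innerSL ℝ u)) =
      innerSL ℝ (L (1, 0) • a + L (0, 1) • u) := by
    ext y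
    simp [hL (inner ℝ a y, inner ℝ u y)]
  rw [e1, innerSL_apply_norm]
  have e2 : ‖L (1, 0) • a + L (0, 1) • u‖ ^ 2 =
      (L (1, 0) + L (0, 1) * inner ℝ a u) ^ 2 + (L (0, 1) * s) ^ 2 := by
    rw [norm_add_sq_real, norm_smul, norm_smul, inner_smul_left, inner_smul_right, ha, hu]
    simp only [mul_one, Real.norm_eq_abs, sq_abs, RCLike.conj_to_real]
    linear_combination (-L (0, 1) ^ 2) * hs
  congr 1
  simp only [ContinuousLinearMap.comp_apply, ContinuousLinearMap.inl_apply,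
    ContinuousLinearMap.inr_apply, ContinuousLinearMap.prod_apply, add_apply,
    smul_apply, ContinuousLinearMap.coe_fst', ContinuousLinearMap.coe_snd',
    smul_eq_mul]
  rw [← Complex.ofReal_pow, e2, hL (1, inner ℝ a u * 1 + s * 0),
    hL (0, inner ℝ a u * 0 + s * 1)]
  push_cast
  ring

/-- A Gaussian form of the Funk–Hecke formula for the kernel `|⟪x, y⟫| ^ q`. -/
theorem integral_abs_inner_rpow_mul_hermite {q : ℝ} (hq : 0 < q) (hq1 : q ≤ 1) (a : E) {u : E}
    (hu : ‖u‖ = 1) (m : ℕ) :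
    ∫ y, |inner ℝ a y| ^ q * aeval (inner ℝ u y) (hermite m) ∂stdGaussian E =
      hermiteMoment q m * (‖a‖ ^ q * (inner ℝ u a / ‖a‖) ^ m) := by
  rcases eq_or_ne a 0 with rfl | ha
  · simp [Real.zero_rpow hq.ne']
  have ha0 : 0 < ‖a‖ := norm_pos_iff.2 ha
  set b : E := ‖a‖⁻¹ • a with hb
  have hb1 : ‖b‖ = 1 := by rw [hb, norm_smul]; simp [ha]
  have hab (y : E) : inner ℝ a y = ‖a‖ * inner ℝ b y := by
    rw [hb, real_inner_smul_left]; field_simp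
  have hub : inner ℝ u a / ‖a‖ = inner ℝ b u := by
    rw [hb, real_inner_smul_left, real_inner_comm]; field_simp
  obtain ⟨s, hs⟩ := exists_sq_add_sq_eq_one hb1 hu
  have e (y : E) : |inner ℝ a y| ^ q * aeval (inner ℝ u y) (hermite m) =
      ‖a‖ ^ q * (|inner ℝ b y| ^ q * aeval (inner ℝ u y) (hermite m)) := by
    rw [hab, abs_mul, Real.mul_rpow (abs_nonneg _) (abs_nonneg _), abs_norm, mul_assoc]
  simp_rw [e]
  rw [integral_const_mul, hub, mul_left_comm]
  congr 1
  have mh : Measurable (fun p : ℝ × ℝ ↦ |p.1| ^ q * aeval p.2 (hermite m)) := by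
    have : Continuous fun x : ℝ ↦ aeval x (hermite m) := (hermite m).continuous_aeval
    fun_prop
  have mb : Measurable (fun y : E ↦ (inner ℝ b y, inner ℝ u y)) := by fun_prop
  have hint : Integrable (fun y : E ↦ |inner ℝ b y| ^ q * aeval (inner ℝ u y) (hermite m))
      (stdGaussian E) :=
    (((HasPolyGrowth.inner_left b).abs_rpow hq.le hq1).mul
      ((HasPolyGrowth.inner_left u).aeval _)).integrable _
  have law := map_inner_prod_stdGaussian hb1 hu hs
  have h1 := integral_map (μ := stdGaussian E) mb.aemeasurable mh.aestronglyMeasurable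
  have h2 := (integrable_map_measure (μ := stdGaussian E) mh.aestronglyMeasurable
    mb.aemeasurable).2 hint
  have mp : Measurable (fun p : ℝ × ℝ ↦ (p.1, inner ℝ b u * p.1 + s * p.2)) := by fun_prop
  rw [law, integrable_map_measure mh.aestronglyMeasurable mp.aemeasurable] at h2
  -- With `⟪u, y⟫` written as `t * z + s * w`, integrating over `w` first gives `t ^ m * H_m(z)` and
  -- leaves a one-dimensional moment.
  rw [← h1, law, integral_map mp.aemeasurable mh.aestronglyMeasurable, integral_prod (fun p : ℝ × ℝ ↦ |p.1| ^ q * aeval (inner ℝ b u * p.1 + s * p.2) (hermite m)) h2]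
  simp_rw [integral_const_mul, integral_aeval_hermite_comp_affine hs, hermiteMoment,
    ← integral_mul_const]
  congr 1 with z
  ring

/-- Duality: the `q`-cosine transform of `w μ` tested against a Hermite polynomial. -/
theorem integral_integral_abs_inner_rpow_mul_hermite {q : ℝ} (hq : 0 < q) (hq1 : q ≤ 1) {u : E}
    (hu : ‖u‖ = 1) (m : ℕ) {μ : Measure E} [SFinite μ] {w : E → ℝ} (hw : Measurable w)
    (hint : Integrable (fun y ↦ ‖y‖ ^ q * w y) μ) :
    ∫ x, (∫ y, |inner ℝ x y| ^ q * w y ∂μ) * aeval (inner ℝ u x) (hermite m) ∂stdGaussian E =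
      hermiteMoment q m * ∫ y, ‖y‖ ^ q * (inner ℝ u y / ‖y‖) ^ m * w y ∂μ := by
  have ch : Continuous fun x : ℝ ↦ aeval x (hermite m) := (hermite m).continuous_aeval
  have hI : Integrable (fun p : E × E ↦ (|inner ℝ p.1 p.2| ^ q * w p.2) *
      aeval (inner ℝ u p.1) (hermite m)) ((stdGaussian E).prod μ) := by
    have g : HasPolyGrowth (fun x : E ↦ ‖x‖ ^ q * aeval (inner ℝ u x) (hermite m)) :=
      (HasPolyGrowth.norm_rpow hq.le hq1).mul ((HasPolyGrowth.inner_left u).aeval _)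
    refine ((g.integrable (stdGaussian E)).mul_prod hint).mono
      (Measurable.aestronglyMeasurable (by fun_prop)) (ae_of_all _ fun p ↦ ?_)
    simp only [norm_mul, Real.norm_eq_abs]
    have h1 : |(|inner ℝ p.1 p.2| ^ q)| ≤ |(‖p.1‖ ^ q)| * |(‖p.2‖ ^ q)| := by
      rw [← abs_mul, ← Real.mul_rpow (norm_nonneg _) (norm_nonneg _),
        abs_of_nonneg (Real.rpow_nonneg (abs_nonneg _) q)]
      exact (Real.rpow_le_rpow (abs_nonneg _) (abs_real_inner_le_norm _ _) hq.le).trans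
        (le_abs_self _)
    calc _ ≤ |(‖p.1‖ ^ q)| * |(‖p.2‖ ^ q)| * |w p.2| * |aeval (inner ℝ u p.1) (hermite m)| := by
          gcongr
      _ = _ := by ring
  simp_rw [← integral_mul_const]
  rw [integral_integral_swap hI]
  calc _ = ∫ y, w y * ∫ x, |inner ℝ y x| ^ q * aeval (inner ℝ u x) (hermite m) ∂stdGaussian E
        ∂μ := by
        congr 1 with y
        rw [← integral_const_mul]
        congr 1 with x
        rw [real_inner_comm]
        ring
    _ = _ := by
        simp_rw [integral_abs_inner_rpow_mul_hermite hq hq1 _ hu]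
        rw [← integral_const_mul]
        congr 1 with y
        ring

/-- Testing both sides against `H_{2n}` produces the same nonzero factor `hermiteMoment q (2 * n)`,
which cancels whatever its sign. What remains for `μ` is an integral of an even power. -/
lemma integral_nonneg_of_cosineTransform_eq {q : ℝ} (hq : 0 < q) (hq1 : q < 1) {u : E}
    (hu : ‖u‖ = 1) {μ : Measure E} [SFinite μ] (hμ : Integrable (fun y ↦ ‖y‖ ^ q) μ) {w : E → ℝ}
    (hw : HasPolyGrowth w) {c : ℝ} (hc : 0 < c)
    (h : ∀ x, ∫ y, |inner ℝ x y| ^ q * w y ∂stdGaussian E = c * ∫ y, |inner ℝ x y| ^ q ∂μ)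
    (n : ℕ) :
    0 ≤ ∫ y, ‖y‖ ^ q * (inner ℝ u y / ‖y‖) ^ (2 * n) * w y ∂stdGaussian E := by
  have h1 := integral_integral_abs_inner_rpow_mul_hermite hq hq1.le hu (2 * n) (μ := μ)
    (w := fun _ ↦ c) measurable_const (hμ.mul_const c)
  have h2 := integral_integral_abs_inner_rpow_mul_hermite hq hq1.le hu (2 * n)
    (μ := stdGaussian E) hw.1 (((HasPolyGrowth.norm_rpow hq.le hq1.le).mul hw).integrable _)
  simp_rw [h] at h2
  simp_rw [integral_mul_const, mul_comm _ c] at h1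
  rw [h1] at h2
  rw [← mul_left_cancel₀ (hermiteMoment_two_mul_ne_zero hq hq1 n) h2]
  refine mul_nonneg hc.le (integral_nonneg fun y ↦ ?_)
  rw [pow_mul]
  positivity

instance isOpenPosMeasure_gaussianReal : (gaussianReal 0 1).IsOpenPosMeasure :=
  (gaussianReal_absolutelyContinuous' 0 one_ne_zero).isOpenPosMeasure

instance isOpenPosMeasure_stdGaussian {ι : Type*} [Fintype ι] :
    (stdGaussian (EuclideanSpace ℝ ι)).IsOpenPosMeasure := by
  rw [← map_pi_eq_stdGaussian]
  exact (PiLp.continuous_toLp 2 _).isOpenPosMeasure_map (WithLp.toLp_surjective 2)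

/-- Powers of the squared cosine of the angle with `u` concentrate at `u`. -/
lemma nonneg_of_forall_integral_nonneg {u : E} (hu : ‖u‖ = 1) {μ : Measure E}
    [μ.IsOpenPosMeasure] {G : E → ℝ} (hG : Integrable G μ) (hG0 : ∀ y, 0 ≤ G y)
    (hGpos : ∀ y, y ≠ 0 → 0 < G y) {p D : ℝ} (hD : 0 < D)
    (h : ∀ n : ℕ, 0 ≤ ∫ y, ((inner ℝ u y / ‖y‖) ^ 2) ^ n *
      (G y * (p + D * (1 - (inner ℝ u y / ‖y‖) ^ 2))) ∂μ) :
    0 ≤ p := by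
  by_contra! hp
  set t : E → ℝ := fun y ↦ (inner ℝ u y / ‖y‖) ^ 2 with ht
  have t0 (y : E) : 0 ≤ t y := sq_nonneg _
  have t1 (y : E) : t y ≤ 1 := by
    rw [ht, sq_le_one_iff_abs_le_one, abs_div, abs_norm]
    exact div_le_one_of_le₀ (by simpa [hu] using abs_real_inner_le_norm u y) (norm_nonneg _)
  have tm : Measurable t := by fun_prop
  have ti (n : ℕ) : Integrable (fun y ↦ t y ^ n * G y) μ := by
    refine hG.mono ((tm.pow_const n).aestronglyMeasurable.mul hG.1) (ae_of_all _ fun y ↦ ?_)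
    rw [norm_mul, Real.norm_of_nonneg (pow_nonneg (t0 y) n)]
    exact mul_le_of_le_one_left (norm_nonneg _) (pow_le_one₀ (t0 y) (t1 y))
  set a : ℕ → ℝ := fun n ↦ ∫ y, t y ^ n * G y ∂μ with ha
  have a0 (n : ℕ) : 0 ≤ a n := integral_nonneg fun y ↦ mul_nonneg (pow_nonneg (t0 y) n) (hG0 y)
  -- The hypothesis is a recursive bound: if `p < 0`, then `a n` decays geometrically with ratio `κ
  -- < 1`.
  have step (n : ℕ) : D * a (n + 1) ≤ (p + D) * a n := by
    have e : ∫ y, t y ^ n * (G y * (p + D * (1 - t y))) ∂μ = (p + D) * a n - D * a (n + 1) := by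
      rw [ha, ← integral_const_mul, ← integral_const_mul,
        ← integral_sub ((ti n).const_mul _) ((ti (n + 1)).const_mul _)]
      congr 1 with y
      ring
    have := h n
    rw [e] at this
    linarith
  set κ := max ((p + D) / D) 0 with hκ
  have κ0 : 0 ≤ κ := le_max_right _ _
  have κ1 : κ < 1 := max_lt (by rw [div_lt_one hD]; linarith) one_pos
  have bound (n : ℕ) : a n ≤ κ ^ n * a 0 := by
    induction n with
    | zero => simp
    | succ n ih =>
      have h1 : a (n + 1) ≤ (p + D) / D * a n := by
        rw [div_mul_eq_mul_div, le_div_iff₀ hD]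
        linarith [step n]
      calc a (n + 1) ≤ κ * a n := h1.trans (mul_le_mul_of_nonneg_right (le_max_left _ _) (a0 n))
        _ ≤ κ * (κ ^ n * a 0) := by gcongr
        _ = _ := by ring
  -- On the open neighbourhood `t > ρ` of `u`, which has positive mass, `a n` is at least a constant
  -- times `ρ ^ n`. This contradicts decay at the smaller rate `κ`.
  obtain ⟨ρ, hρ, hρ1⟩ := exists_between κ1
  have ρ0 : 0 < ρ := κ0.trans_lt hρ
  set S : Set E := {y | y ≠ 0 ∧ ρ < t y} with hS
  have hSo : IsOpen S := by
    have hc : ContinuousOn t {0}ᶜ := by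
      refine (ContinuousOn.div (by fun_prop) (by fun_prop) fun y hy ↦ ?_).pow 2
      simpa using hy
    exact hc.isOpen_inter_preimage isOpen_compl_singleton isOpen_Ioi
  have huS : u ∈ S := by
    refine ⟨fun h0 ↦ by simp [h0] at hu, ?_⟩
    simpa [ht, hu, real_inner_self_eq_norm_sq] using hρ1
  have hSI : 0 < ∫ y in S, G y ∂μ := by
    rw [setIntegral_pos_iff_support_of_nonneg_ae (ae_of_all _ hG0) hG.integrableOn]
    have : Function.support G ∩ S = S :=
      Set.inter_eq_right.2 fun y hy ↦ (hGpos y hy.1).ne'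
    rw [this]
    exact hSo.measure_pos μ ⟨u, huS⟩
  have lower (n : ℕ) : ρ ^ n * ∫ y in S, G y ∂μ ≤ a n := by
    rw [← integral_const_mul]
    refine (setIntegral_mono_on (hG.integrableOn.const_mul _) (ti n).integrableOn
      hSo.measurableSet fun y hy ↦ ?_).trans (setIntegral_le_integral (ti n)
        (ae_of_all _ fun y ↦ mul_nonneg (pow_nonneg (t0 y) n) (hG0 y)))
    exact mul_le_mul_of_nonneg_right (pow_le_pow_left₀ ρ0.le hy.2.le n) (hG0 y)
  have lim : Filter.Tendsto (fun n : ℕ ↦ (κ / ρ) ^ n * a 0) Filter.atTop (nhds 0) := by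
    simpa using (tendsto_pow_atTop_nhds_zero_of_lt_one (by positivity)
      (by rwa [div_lt_one ρ0])).mul_const (a 0)
  refine absurd (ge_of_tendsto' lim fun n ↦ ?_) (not_le.2 hSI)
  rw [div_pow, div_mul_eq_mul_div, le_div_iff₀ (by positivity), mul_comm]
  exact (lower n).trans (bound n)

end GaussianFunkHecke

/-! ### Embeddings into `L_q` as `q`-cosine transforms of measures -/

section CosineTransform

variable {ι : Type*} [Fintype ι]

lemma rpow_norm_eq_integral {q : ℝ≥0∞} (hq0 : q ≠ 0) (hq : q ≠ ⊤) {μ : Measure ℝ}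
    (f : Lp ℝ q μ) : ‖f‖ ^ q.toReal = ∫ t, |f t| ^ q.toReal ∂μ := by
  have hr := ENNReal.toReal_pos hq0 hq
  rw [Lp.norm_def, (Lp.memLp f).eLpNorm_eq_integral_rpow_norm hq0 hq,
    ENNReal.toReal_ofReal (by positivity), ← Real.rpow_mul (by positivity),
    inv_mul_cancel₀ hr.ne', Real.rpow_one]
  rfl

/-- The coordinates of an isometric embedding into `L_q` represent `N ^ q` as the `q`-cosine
transform of a finite measure. -/
theorem EmbedsIsometricallyInL.exists_measure {N : (ι → ℝ) → ℝ} {hN : IsNorm N} {q : ℝ≥0∞}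
    (hq0 : q ≠ 0) (hq : q ≠ ⊤) (h : EmbedsIsometricallyInL (NormedBy N hN) q) :
    ∃ μ : Measure (EuclideanSpace ℝ ι), IsFiniteMeasure μ ∧
      Integrable (fun y ↦ ‖y‖ ^ q.toReal) μ ∧
      ∀ x : EuclideanSpace ℝ ι, ∫ y, |inner ℝ x y| ^ q.toReal ∂μ = N x.ofLp ^ q.toReal := by
  classical
  obtain ⟨T, hT⟩ := h
  have hr := ENNReal.toReal_pos hq0 hq
  let T' : (ι → ℝ) →ₗ[ℝ] Lp ℝ q (volume.restrict (Set.Icc (0 : ℝ) 1)) := T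
  have hT' (x : ι → ℝ) : ‖T' x‖ = N x := hT x
  let f (i : ι) : ℝ → ℝ := T' (Pi.single i 1)
  have fm (i : ι) : Measurable (f i) := (Lp.stronglyMeasurable (T' (Pi.single i 1))).measurable
  -- The measure is the law of the vector of images of the basis; by linearity `⟪x, F t⟫` is almost
  -- everywhere the image of `x`.
  let F : ℝ → EuclideanSpace ℝ ι := fun t ↦ WithLp.toLp 2 fun i ↦ f i t
  have Fm : Measurable F := by fun_prop
  have hF (x : EuclideanSpace ℝ ι) :
      (fun t ↦ inner ℝ x (F t)) =ᵐ[volume.restrict (Set.Icc (0 : ℝ) 1)] T' x.ofLp := by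
    have e : T' x.ofLp = ∑ i, x i • T' (Pi.single i 1) := by
      conv_lhs => rw [pi_eq_sum_univ' x.ofLp]
      simp only [map_sum, map_smul]
    rw [e]
    have h1 := Lp.coeFn_fun_finsetSum Finset.univ (fun i ↦ x i • T' (Pi.single i 1))
    have h2 : ∀ᵐ t ∂volume.restrict (Set.Icc (0 : ℝ) 1), ∀ i,
        (x i • T' (Pi.single i 1) : Lp ℝ q (volume.restrict (Set.Icc (0 : ℝ) 1))) t =
          x i * f i t :=
      ae_all_iff.2 fun i ↦ Lp.coeFn_smul (x i) (T' (Pi.single i 1))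
    filter_upwards [h1, h2] with t h1 h2
    rw [h1]
    simp [F, PiLp.inner_apply, h2, mul_comm]
  refine ⟨(volume.restrict (Set.Icc (0 : ℝ) 1)).map F, inferInstance, ?_, fun x ↦ ?_⟩
  · rw [integrable_map_measure (Measurable.aestronglyMeasurable (by fun_prop)) Fm.aemeasurable]
    have h1 : MemLp (fun t ↦ ∑ i, |f i t|) q (volume.restrict (Set.Icc (0 : ℝ) 1)) :=
      memLp_finsetSum _ fun i _ ↦ (Lp.memLp (T' (Pi.single i 1))).norm
    have h2 : MemLp F q (volume.restrict (Set.Icc (0 : ℝ) 1)) := by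
      refine h1.mono Fm.aestronglyMeasurable (ae_of_all _ fun t ↦ ?_)
      rw [Real.norm_of_nonneg (by positivity), EuclideanSpace.norm_eq]
      refine Real.sqrt_le_iff.2 ⟨by positivity, ?_⟩
      exact Finset.sum_sq_le_sq_sum_of_nonneg fun i _ ↦ abs_nonneg _
    exact h2.integrable_norm_rpow hq0 hq
  · rw [integral_map Fm.aemeasurable (Measurable.aestronglyMeasurable (by fun_prop)),
      ← hT', rpow_norm_eq_integral hq0 hq]
    refine integral_congr_ae ?_
    filter_upwards [hF x] with t ht
    rw [ht]

/-- The normalized measure is the image of Lebesgue measure on `[0, 1]` under some `g`, so `x ↦ ⟪x,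
g⟫` embeds up to a scalar; the total mass to the power `1 / q` corrects the scale. -/
theorem embedsIsometricallyInL_of_measure {N : (ι → ℝ) → ℝ} {hN : IsNorm N} {q : ℝ≥0∞}
    (hq0 : q ≠ 0) (hq : q ≠ ⊤) {μ : Measure (EuclideanSpace ℝ ι)} [IsFiniteMeasure μ] [NeZero μ]
    (hμ : Integrable (fun y ↦ ‖y‖ ^ q.toReal) μ)
    (h : ∀ x : EuclideanSpace ℝ ι, ∫ y, |inner ℝ x y| ^ q.toReal ∂μ = N x.ofLp ^ q.toReal) :
    EmbedsIsometricallyInL (NormedBy N hN) q := by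
  have hr := ENNReal.toReal_pos hq0 hq
  obtain ⟨f, fm, hf⟩ := Measure.exists_measurable_map_eq ((μ Set.univ)⁻¹ • μ)
  let g : ℝ → EuclideanSpace ℝ ι := fun t ↦ f (Set.projIcc 0 1 zero_le_one t)
  have gm : Measurable g := fm.comp continuous_projIcc.measurable
  have hg : (volume.restrict (Set.Icc (0 : ℝ) 1)).map g = (μ Set.univ)⁻¹ • μ := by
    rw [← hf, ← map_comap_subtype_coe measurableSet_Icc, Measure.map_map gm measurable_subtype_coe]
    congr 1
    ext t
    simp [g]
  have hM : 0 < μ.real Set.univ := by simp [measureReal_def, ENNReal.toReal_pos_iff, NeZero.pos]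
  let c : ℝ := μ.real Set.univ ^ q.toReal⁻¹
  have hc : c ^ q.toReal = μ.real Set.univ := by
    rw [← Real.rpow_mul hM.le, inv_mul_cancel₀ hr.ne', Real.rpow_one]
  have gL : MemLp g q (volume.restrict (Set.Icc (0 : ℝ) 1)) := by
    rw [← integrable_norm_rpow_iff gm.aestronglyMeasurable hq0 hq]
    have := hμ.smul_measure (c := (μ Set.univ)⁻¹) (by simp [NeZero.ne μ])
    rw [← hg, integrable_map_measure (Measurable.aestronglyMeasurable (by fun_prop))
      gm.aemeasurable] at this
    exact this
  have hL (x : EuclideanSpace ℝ ι) : MemLp (fun t ↦ c * inner ℝ x (g t)) q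
      (volume.restrict (Set.Icc (0 : ℝ) 1)) := (gL.const_inner x).const_mul c
  let T : (ι → ℝ) →ₗ[ℝ] Lp ℝ q (volume.restrict (Set.Icc (0 : ℝ) 1)) :=
    { toFun x := (hL (WithLp.toLp 2 x)).toLp
      map_add' x y := by
        rw [← MemLp.toLp_add]
        refine MemLp.toLp_congr (hL _)
          ((hL (WithLp.toLp 2 x)).add (hL (WithLp.toLp 2 y))) (ae_of_all _ fun t ↦ ?_)
        simp [inner_add_left, mul_add]
      map_smul' a x := by
        rw [RingHom.id_apply, ← MemLp.toLp_const_smul]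
        refine MemLp.toLp_congr (hL _)
          ((hL (WithLp.toLp 2 x)).const_smul a) (ae_of_all _ fun t ↦ ?_)
        simp [inner_smul_left, mul_left_comm] }
  have hT (x : ι → ℝ) : ‖T x‖ = N x := by
    have h0 : 0 ≤ ‖T x‖ := ENNReal.toReal_nonneg
    refine (Real.rpow_left_inj h0 (hN.nonneg x) hr.ne').1 ?_
    rw [rpow_norm_eq_integral hq0 hq, ← h (WithLp.toLp 2 x)]
    calc _ = ∫ t in Set.Icc (0 : ℝ) 1,
          μ.real Set.univ * |inner ℝ (WithLp.toLp 2 x) (g t)| ^ q.toReal := by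
          refine integral_congr_ae ?_
          filter_upwards [(hL (WithLp.toLp 2 x)).coeFn_toLp] with t ht
          have : (T x) t = c * inner ℝ (WithLp.toLp 2 x) (g t) := ht
          rw [this, abs_mul, Real.mul_rpow (abs_nonneg _) (abs_nonneg _),
            abs_of_nonneg (by positivity : 0 ≤ c), hc]
      _ = μ.real Set.univ * ∫ y, |inner ℝ (WithLp.toLp 2 x) y| ^ q.toReal
          ∂(volume.restrict (Set.Icc (0 : ℝ) 1)).map g := by
          rw [integral_const_mul, integral_map gm.aemeasurable
            (Measurable.aestronglyMeasurable (by fun_prop))]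
      _ = _ := by
          rw [hg, integral_smul_measure, ENNReal.toReal_inv, smul_eq_mul, ← measureReal_def,
            mul_inv_cancel_left₀ hM.ne']
  exact ⟨T, hT⟩

end CosineTransform

/-! ### Cosine transforms of quadratic and quartic weights -/

section GaussianMoments

open ProbabilityTheory Polynomial

variable {E : Type*} [NormedAddCommGroup E] [InnerProductSpace ℝ E] [FiniteDimensional ℝ E]
  [MeasurableSpace E] {q : ℝ}

/-- The `q`-cosine transform of the weighted Gaussian measure with weight `w`. -/
noncomputable def gaussCosine (q : ℝ) (w : E → ℝ) (x : E) : ℝ :=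
  ∫ y, |inner ℝ x y| ^ q * w y ∂stdGaussian E

lemma gaussCosine_const_mul (c : ℝ) (w : E → ℝ) (x : E) :
    gaussCosine q (fun y ↦ c * w y) x = c * gaussCosine q w x := by
  simp only [gaussCosine, mul_left_comm _ c, integral_const_mul]

variable [BorelSpace E]

lemma integrable_abs_inner_rpow_mul (hq : 0 < q) (hq1 : q ≤ 1) {w : E → ℝ} (hw : HasPolyGrowth w)
    (x : E) : Integrable (fun y ↦ |inner ℝ x y| ^ q * w y) (stdGaussian E) :=
  (((HasPolyGrowth.inner_left x).abs_rpow hq.le hq1).mul hw).integrable _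

lemma gaussCosine_add (hq : 0 < q) (hq1 : q ≤ 1) {v w : E → ℝ} (hv : HasPolyGrowth v)
    (hw : HasPolyGrowth w) (x : E) :
    gaussCosine q (fun y ↦ v y + w y) x = gaussCosine q v x + gaussCosine q w x := by
  simp only [gaussCosine, mul_add]
  exact integral_add (integrable_abs_inner_rpow_mul hq hq1 hv x)
    (integrable_abs_inner_rpow_mul hq hq1 hw x)

lemma gaussCosine_hermite (hq : 0 < q) (hq1 : q ≤ 1) {u : E} (hu : ‖u‖ = 1) (m : ℕ) (x : E) :
    gaussCosine q (fun y ↦ aeval (inner ℝ u y) (hermite m)) x =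
      hermiteMoment q m * (‖x‖ ^ q * (inner ℝ u x / ‖x‖) ^ m) :=
  integral_abs_inner_rpow_mul_hermite hq hq1 x hu m

lemma gaussCosine_sq (hq : 0 < q) (hq1 : q ≤ 1) {u : E} (hu : ‖u‖ = 1) (x : E) :
    gaussCosine q (fun y ↦ inner ℝ u y ^ 2) x =
      hermiteMoment q 0 * ‖x‖ ^ q * (1 + q * (inner ℝ u x / ‖x‖) ^ 2) := by
  have gh (m : ℕ) : HasPolyGrowth (fun y ↦ aeval (inner ℝ u y) (hermite m)) :=
    (HasPolyGrowth.inner_left u).aeval _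
  have e : (fun y ↦ inner ℝ u y ^ 2) = fun y ↦
      aeval (inner ℝ u y) (hermite 2) + aeval (inner ℝ u y) (hermite 0) := by
    ext y
    rw [aeval_hermite_succ_succ]
    simp
    ring
  rw [e, gaussCosine_add hq hq1 (gh 2) (gh 0), gaussCosine_hermite hq hq1 hu,
    gaussCosine_hermite hq hq1 hu, hermiteMoment_add_two hq hq1 0]
  push_cast
  ring

lemma gaussCosine_pow_four_of_norm_eq_one (hq : 0 < q) (hq1 : q ≤ 1) {u : E} (hu : ‖u‖ = 1)
    (x : E) : gaussCosine q (fun y ↦ inner ℝ u y ^ 4) x = hermiteMoment q 0 * ‖x‖ ^ q *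
      (3 + 6 * q * (inner ℝ u x / ‖x‖) ^ 2 + q * (q - 2) * (inner ℝ u x / ‖x‖) ^ 4) := by
  have gh (m : ℕ) : HasPolyGrowth (fun y ↦ aeval (inner ℝ u y) (hermite m)) :=
    (HasPolyGrowth.inner_left u).aeval _
  have e : (fun y ↦ inner ℝ u y ^ 4) = fun y ↦
      aeval (inner ℝ u y) (hermite 4) + (6 * aeval (inner ℝ u y) (hermite 2) +
        3 * aeval (inner ℝ u y) (hermite 0)) := by
    ext y
    rw [aeval_hermite_succ_succ, aeval_hermite_succ_succ, aeval_hermite_succ_succ]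
    simp
    ring
  rw [e, gaussCosine_add hq hq1 (gh 4) (((gh 2).const_mul 6).add ((gh 0).const_mul 3)),
    gaussCosine_add hq hq1 ((gh 2).const_mul 6) ((gh 0).const_mul 3), gaussCosine_const_mul,
    gaussCosine_const_mul, gaussCosine_hermite hq hq1 hu, gaussCosine_hermite hq hq1 hu,
    gaussCosine_hermite hq hq1 hu, hermiteMoment_add_two hq hq1 2, hermiteMoment_add_two hq hq1 0]
  push_cast
  ring

lemma gaussCosine_pow_four (hq : 0 < q) (hq1 : q ≤ 1) {u : E} (hu : u ≠ 0) (x : E) :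
    gaussCosine q (fun y ↦ inner ℝ u y ^ 4) x = hermiteMoment q 0 * ‖x‖ ^ q *
      (3 * ‖u‖ ^ 4 + 6 * q * ‖u‖ ^ 2 * (inner ℝ u x / ‖x‖) ^ 2 +
        q * (q - 2) * (inner ℝ u x / ‖x‖) ^ 4) := by
  have h0 : ‖u‖ ≠ 0 := norm_ne_zero_iff.2 hu
  have hb (y : E) : inner ℝ u y = ‖u‖ * inner ℝ (‖u‖⁻¹ • u) y := by
    rw [real_inner_smul_left]; field_simp
  have h1 : ‖‖u‖⁻¹ • u‖ = 1 := by rw [norm_smul]; simp [hu]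
  simp_rw [hb, mul_pow]
  rw [gaussCosine_const_mul, gaussCosine_pow_four_of_norm_eq_one hq hq1 h1]
  ring

lemma gaussCosine_sq_mul_sq (hq : 0 < q) (hq1 : q ≤ 1) {u v : E} (hu : ‖u‖ = 1) (hv : ‖v‖ = 1)
    (huv : inner ℝ u v = 0) (x : E) :
    gaussCosine q (fun y ↦ inner ℝ u y ^ 2 * inner ℝ v y ^ 2) x = hermiteMoment q 0 * ‖x‖ ^ q *
      (1 + q * ((inner ℝ u x / ‖x‖) ^ 2 + (inner ℝ v x / ‖x‖) ^ 2) +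
        q * (q - 2) * ((inner ℝ u x / ‖x‖) ^ 2 * (inner ℝ v x / ‖x‖) ^ 2)) := by
  have g (u : E) : HasPolyGrowth (fun y ↦ inner ℝ u y ^ 4) := (HasPolyGrowth.inner_left u).pow 4
  have np : ‖u + v‖ ^ 2 = 2 := by rw [norm_add_sq_real, hu, hv, huv]; norm_num
  have nm : ‖u - v‖ ^ 2 = 2 := by rw [norm_sub_sq_real, hu, hv, huv]; norm_num
  have hp : u + v ≠ 0 := fun h ↦ by simp [h] at np
  have hm : u - v ≠ 0 := fun h ↦ by simp [h] at nm
  -- Polarization reduces the mixed monomial to fourth powers of linear forms.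
  have e : (fun y ↦ inner ℝ u y ^ 2 * inner ℝ v y ^ 2) = fun y ↦ (1 / 12) *
      ((inner ℝ (u + v) y ^ 4 + inner ℝ (u - v) y ^ 4) +
        ((-2) * inner ℝ u y ^ 4 + (-2) * inner ℝ v y ^ 4)) := by
    ext y
    rw [inner_add_left, inner_sub_left]
    ring
  rw [e, gaussCosine_const_mul, gaussCosine_add hq hq1 ((g _).add (g _))
    (((g u).const_mul _).add ((g v).const_mul _)), gaussCosine_add hq hq1 (g _) (g _),
    gaussCosine_add hq hq1 ((g u).const_mul _) ((g v).const_mul _), gaussCosine_const_mul,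
    gaussCosine_const_mul, gaussCosine_pow_four hq hq1 hp, gaussCosine_pow_four hq hq1 hm,
    gaussCosine_pow_four_of_norm_eq_one hq hq1 hu, gaussCosine_pow_four_of_norm_eq_one hq hq1 hv,
    show ‖u + v‖ ^ 4 = (‖u + v‖ ^ 2) ^ 2 by ring, show ‖u - v‖ ^ 4 = (‖u - v‖ ^ 2) ^ 2 by ring,
    np, nm, inner_add_left, inner_sub_left]
  ring

/-- If `N ^ q` is the `q`-cosine transform both of a measure and of a homogeneous weight `w`, then
`w` is nonnegative at `u`. Here `p` is the value of a bound for `w` at `u`. -/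
lemma nonneg_of_gaussCosine_eq {ι : Type*} [Fintype ι] (hq : 0 < q) (hq1 : q < 1)
    {u : EuclideanSpace ℝ ι} (hu : ‖u‖ = 1)
    {μ : Measure (EuclideanSpace ℝ ι)} [SFinite μ] (hμ : Integrable (fun y ↦ ‖y‖ ^ q) μ)
    {w : EuclideanSpace ℝ ι → ℝ} (hw : HasPolyGrowth w) {c : ℝ} (hc : 0 < c)
    (h : ∀ x, gaussCosine q w x = c * ∫ y, |inner ℝ x y| ^ q ∂μ) {d : ℕ} {p D : ℝ} (hD : 0 < D)
    (hwle : ∀ y, w y ≤ ‖y‖ ^ d * (p + D * (1 - (inner ℝ u y / ‖y‖) ^ 2))) : 0 ≤ p := by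
  have gG : HasPolyGrowth (fun y : EuclideanSpace ℝ ι ↦ ‖y‖ ^ q * ‖y‖ ^ d) :=
    (HasPolyGrowth.norm_rpow hq.le hq1.le).mul (HasPolyGrowth.norm.pow d)
  have gt : HasPolyGrowth (fun y : EuclideanSpace ℝ ι ↦ inner ℝ u y / ‖y‖) := by
    refine (HasPolyGrowth.const 1).mono (by fun_prop) fun y ↦ ?_
    rw [abs_div, abs_norm, abs_one]
    exact div_le_one_of_le₀ (by simpa [hu] using abs_real_inner_le_norm u y) (norm_nonneg _)
  refine nonneg_of_forall_integral_nonneg hu (μ := stdGaussian (EuclideanSpace ℝ ι))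
    (gG.integrable _) (fun y ↦ by positivity) (fun y hy ↦ ?_) hD fun n ↦ ?_
  · have := norm_pos_iff.2 hy
    positivity
  · refine (integral_nonneg_of_cosineTransform_eq hq hq1 hu hμ hw hc h n).trans
      (integral_mono ?_ ?_ fun y ↦ ?_)
    · exact (((HasPolyGrowth.norm_rpow hq.le hq1.le).mul (gt.pow _)).mul hw).integrable _
    · exact (((gt.pow 2).pow n).mul (gG.mul ((HasPolyGrowth.const p).add
        (((HasPolyGrowth.const 1).sub (gt.pow 2)).const_mul D)))).integrable _
    · simp only
      rw [pow_mul]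
      calc _ ≤ ‖y‖ ^ q * ((inner ℝ u y / ‖y‖) ^ 2) ^ n *
            (‖y‖ ^ d * (p + D * (1 - (inner ℝ u y / ‖y‖) ^ 2))) := by
            gcongr
            exact hwle y
        _ = _ := by ring

end GaussianMoments

/-! ### The explicit weights and the thresholds `1/26` and `1/28` -/

section PerturbedNorm

open ProbabilityTheory

lemma perturbedNorm_ofLp (lam : ℝ) (x : EuclideanSpace ℝ (Fin 3)) :
    perturbedNorm lam x.ofLp = ‖x‖ * (1 + lam * (1 - 3 * (x 2 / ‖x‖) ^ 2)) ^ 4 := by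
  have hn : ‖x‖ ^ 2 = x 0 ^ 2 + x 1 ^ 2 + x 2 ^ 2 := by
    rw [EuclideanSpace.real_norm_sq_eq, Fin.sum_univ_three]
  have hs : √(x 0 ^ 2 + x 1 ^ 2 + x 2 ^ 2) = ‖x‖ := by rw [← hn, Real.sqrt_sq (norm_nonneg _)]
  rw [perturbedNorm, hs, ← hn]
  rcases eq_or_ne ‖x‖ 0 with h | h
  · simp [h]
  · have : x 0 ^ 2 + x 1 ^ 2 - 2 * x 2 ^ 2 = ‖x‖ ^ 2 - 3 * x 2 ^ 2 := by rw [hn]; ring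
    rw [this]
    field_simp

lemma div_norm_sq_le_one (x : EuclideanSpace ℝ (Fin 3)) (i : Fin 3) : (x i / ‖x‖) ^ 2 ≤ 1 := by
  rw [sq_le_one_iff_abs_le_one, abs_div, abs_norm]
  exact div_le_one_of_le₀ (PiLp.norm_apply_le x i) (norm_nonneg _)

/-- The exponent `4 * q` is `1` for `q = 1/4` and `2` for `q = 1/2`. The bound on `lam` keeps the
base nonnegative. -/
lemma perturbedNorm_ofLp_rpow {lam : ℝ} (h0 : 0 < lam) (h1 : lam ≤ 1 / 2) (q : ℝ)
    (x : EuclideanSpace ℝ (Fin 3)) : perturbedNorm lam x.ofLp ^ q =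
      ‖x‖ ^ q * (1 + lam * (1 - 3 * (x 2 / ‖x‖) ^ 2)) ^ (4 * q) := by
  have : 0 ≤ 1 + lam * (1 - 3 * (x 2 / ‖x‖) ^ 2) := by nlinarith [div_norm_sq_le_one x 2]
  rw [perturbedNorm_ofLp, Real.mul_rpow (norm_nonneg _) (by positivity), ← Real.rpow_natCast,
    ← Real.rpow_mul this]
  norm_cast

lemma hasPolyGrowth_apply (i : Fin 3) : HasPolyGrowth (fun y : EuclideanSpace ℝ (Fin 3) ↦ y i) :=
  HasPolyGrowth.clm (EuclideanSpace.proj i)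

lemma gaussCosine_apply_sq {q : ℝ} (hq : 0 < q) (hq1 : q ≤ 1) (i : Fin 3)
    (x : EuclideanSpace ℝ (Fin 3)) : gaussCosine q (fun y ↦ y i ^ 2) x =
      hermiteMoment q 0 * ‖x‖ ^ q * (1 + q * (x i / ‖x‖) ^ 2) := by
  simpa [EuclideanSpace.inner_single_left] using
    gaussCosine_sq hq hq1 (u := EuclideanSpace.single i (1 : ℝ)) (by simp) x

lemma gaussCosine_apply_pow_four {q : ℝ} (hq : 0 < q) (hq1 : q ≤ 1) (i : Fin 3)
    (x : EuclideanSpace ℝ (Fin 3)) : gaussCosine q (fun y ↦ y i ^ 4) x =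
      hermiteMoment q 0 * ‖x‖ ^ q *
        (3 + 6 * q * (x i / ‖x‖) ^ 2 + q * (q - 2) * (x i / ‖x‖) ^ 4) := by
  simpa [EuclideanSpace.inner_single_left] using gaussCosine_pow_four_of_norm_eq_one hq hq1
    (u := EuclideanSpace.single i (1 : ℝ)) (by simp) x

lemma gaussCosine_apply_sq_mul_sq {q : ℝ} (hq : 0 < q) (hq1 : q ≤ 1) {i j : Fin 3} (hij : i ≠ j)
    (x : EuclideanSpace ℝ (Fin 3)) : gaussCosine q (fun y ↦ y i ^ 2 * y j ^ 2) x =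
      hermiteMoment q 0 * ‖x‖ ^ q * (1 + q * ((x i / ‖x‖) ^ 2 + (x j / ‖x‖) ^ 2) +
        q * (q - 2) * ((x i / ‖x‖) ^ 2 * (x j / ‖x‖) ^ 2)) := by
  simpa [EuclideanSpace.inner_single_left] using gaussCosine_sq_mul_sq hq hq1
    (u := EuclideanSpace.single i (1 : ℝ))
    (v := EuclideanSpace.single j (1 : ℝ)) (by simp) (by simp)
    (by simp [EuclideanSpace.inner_single_left, hij]) x

/-- The weight whose `1/4`-cosine transform is a multiple of `perturbedNorm lam ^ (1/4)`. -/
noncomputable def quadraticWeight (lam : ℝ) (y : EuclideanSpace ℝ (Fin 3)) : ℝ :=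
  (1 + 13 * lam) * (y 0 ^ 2 + y 1 ^ 2) + (1 - 26 * lam) * y 2 ^ 2

/-- The weight whose `1/2`-cosine transform is a multiple of `perturbedNorm lam ^ (1/2)`. -/
noncomputable def quarticWeight (lam : ℝ) (y : EuclideanSpace ℝ (Fin 3)) : ℝ :=
  (1 + 14 * lam - 23 * lam ^ 2) * ((y 0 ^ 4 + y 1 ^ 4) + 2 * (y 0 ^ 2 * y 1 ^ 2)) +
  ((2 - 14 * lam + 164 * lam ^ 2) * (y 0 ^ 2 * y 2 ^ 2 + y 1 ^ 2 * y 2 ^ 2) +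
  (1 - 28 * lam - 44 * lam ^ 2) * y 2 ^ 4)

lemma sum_div_norm_sq {x : EuclideanSpace ℝ (Fin 3)} (hx : ‖x‖ ≠ 0) :
    (x 0 / ‖x‖) ^ 2 + (x 1 / ‖x‖) ^ 2 + (x 2 / ‖x‖) ^ 2 = 1 := by
  have hn : ‖x‖ ^ 2 = x 0 ^ 2 + x 1 ^ 2 + x 2 ^ 2 := by
    rw [EuclideanSpace.real_norm_sq_eq, Fin.sum_univ_three]
  field_simp
  exact hn.symm

lemma hasPolyGrowth_quadraticWeight (lam : ℝ) : HasPolyGrowth (quadraticWeight lam) := by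
  have g := hasPolyGrowth_apply
  exact ((((g 0).pow 2).add ((g 1).pow 2)).const_mul _).add (((g 2).pow 2).const_mul _)

/-- With `t = x 2 / ‖x‖`, the weight `a(y₀² + y₁²) + b y₂²` transforms into a multiple of `9a/4 + b
+ (b - a)t²/4`. Matching this with `1 + λ - 3λt²` determines `a` and `b` up to scale. -/
lemma gaussCosine_quadraticWeight {lam : ℝ} (h0 : 0 < lam) (h1 : lam ≤ 1 / 2)
    (x : EuclideanSpace ℝ (Fin 3)) : gaussCosine (1 / 4) (quadraticWeight lam) x =
      (13 / 4 * hermiteMoment (1 / 4) 0) * perturbedNorm lam x.ofLp ^ (1 / 4 : ℝ) := by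
  have g := hasPolyGrowth_apply
  have hq : (0 : ℝ) < 1 / 4 := by norm_num
  have hq1 : (1 / 4 : ℝ) ≤ 1 := by norm_num
  have e : quadraticWeight lam = fun y ↦
    (1 + 13 * lam) * (y 0 ^ 2 + y 1 ^ 2) + (1 - 26 * lam) * y 2 ^ 2 := rfl
  rw [e, gaussCosine_add hq hq1 ((((g 0).pow 2).add ((g 1).pow 2)).const_mul _)
    (((g 2).pow 2).const_mul _), gaussCosine_const_mul, gaussCosine_const_mul,
    gaussCosine_add hq hq1 ((g 0).pow 2) ((g 1).pow 2), gaussCosine_apply_sq hq hq1,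
    gaussCosine_apply_sq hq hq1, gaussCosine_apply_sq hq hq1, perturbedNorm_ofLp_rpow h0 h1]
  norm_num only [Real.rpow_one]
  rcases eq_or_ne ‖x‖ 0 with hx | hx
  · simp [hx]
  have hs : (x 0 / ‖x‖) ^ 2 = 1 - (x 1 / ‖x‖) ^ 2 - (x 2 / ‖x‖) ^ 2 := by
    linarith [sum_div_norm_sq hx]
  rw [hs]
  ring

lemma hasPolyGrowth_quarticWeight (lam : ℝ) : HasPolyGrowth (quarticWeight lam) := by
  have g := hasPolyGrowth_apply
  exact (((((g 0).pow 4).add ((g 1).pow 4)).add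
    ((((g 0).pow 2).mul ((g 1).pow 2)).const_mul 2)).const_mul _).add
    (((((g 0).pow 2).mul ((g 2).pow 2)).add (((g 1).pow 2).mul ((g 2).pow 2))).const_mul _ |>.add
      (((g 2).pow 4).const_mul _))

lemma gaussCosine_quarticWeight {lam : ℝ} (h0 : 0 < lam) (h1 : lam ≤ 1 / 2)
    (x : EuclideanSpace ℝ (Fin 3)) : gaussCosine (1 / 2) (quarticWeight lam) x =
      (77 / 4 * hermiteMoment (1 / 2) 0) * perturbedNorm lam x.ofLp ^ (1 / 2 : ℝ) := by
  have g := hasPolyGrowth_apply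
  have hq : (0 : ℝ) < 1 / 2 := by norm_num
  have hq1 : (1 / 2 : ℝ) ≤ 1 := by norm_num
  have g4 (i : Fin 3) := (g i).pow 4
  have g22 (i j : Fin 3) := ((g i).pow 2).mul ((g j).pow 2)
  unfold quarticWeight
  rw [gaussCosine_add hq hq1
      ((((g4 0).add (g4 1)).add ((g22 0 1).const_mul 2)).const_mul _)
      ((((g22 0 2).add (g22 1 2)).const_mul _).add ((g4 2).const_mul _)),
    gaussCosine_add hq hq1 (((g22 0 2).add (g22 1 2)).const_mul _) ((g4 2).const_mul _),
    gaussCosine_const_mul, gaussCosine_const_mul, gaussCosine_const_mul,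
    gaussCosine_add hq hq1 ((g4 0).add (g4 1)) ((g22 0 1).const_mul 2), gaussCosine_const_mul,
    gaussCosine_add hq hq1 (g4 0) (g4 1), gaussCosine_add hq hq1 (g22 0 2) (g22 1 2),
    gaussCosine_apply_pow_four hq hq1, gaussCosine_apply_pow_four hq hq1,
    gaussCosine_apply_pow_four hq hq1, gaussCosine_apply_sq_mul_sq hq hq1 (by decide),
    gaussCosine_apply_sq_mul_sq hq hq1 (by decide), gaussCosine_apply_sq_mul_sq hq hq1 (by decide),
    perturbedNorm_ofLp_rpow h0 h1, show (4 * (1 / 2) : ℝ) = (2 : ℕ) by norm_num, Real.rpow_natCast]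
  rcases eq_or_ne ‖x‖ 0 with hx | hx
  · simp [hx]
  have hs : (x 0 / ‖x‖) ^ 2 = 1 - (x 1 / ‖x‖) ^ 2 - (x 2 / ‖x‖) ^ 2 := by
    linarith [sum_div_norm_sq hx]
  rw [show (x 0 / ‖x‖) ^ 4 = ((x 0 / ‖x‖) ^ 2) ^ 2 by ring, hs]
  ring

lemma norm_sq_eq_div_norm_sq (y : EuclideanSpace ℝ (Fin 3)) :
    ‖y‖ ^ 2 = y 0 ^ 2 + y 1 ^ 2 + y 2 ^ 2 ∧ ‖y‖ ^ 2 * (y 2 / ‖y‖) ^ 2 = y 2 ^ 2 := by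
  have hn : ‖y‖ ^ 2 = y 0 ^ 2 + y 1 ^ 2 + y 2 ^ 2 := by
    rw [EuclideanSpace.real_norm_sq_eq, Fin.sum_univ_three]
  refine ⟨hn, ?_⟩
  rcases eq_or_ne ‖y‖ 0 with h | h
  · rw [norm_eq_zero] at h
    simp [h]
  · field_simp

theorem embedsIsometricallyInL_one_quarter {lam : ℝ} (h0 : 0 < lam) (h1 : lam ≤ 1 / 26)
    (hN : IsNorm (perturbedNorm lam)) :
    EmbedsIsometricallyInL (NormedBy (perturbedNorm lam) hN) (1 / 4) := by
  have hq : (0 : ℝ) < 1 / 4 := by norm_num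
  have hq1 : (1 / 4 : ℝ) ≤ 1 := by norm_num
  have ht : ((1 : ℝ≥0∞) / 4).toReal = 1 / 4 := by simp
  have hw0 (y : EuclideanSpace ℝ (Fin 3)) : 0 ≤ quadraticWeight lam y := by
    have : 0 ≤ 1 - 26 * lam := by linarith
    unfold quadraticWeight
    positivity
  have hc : 0 < 13 / 4 * hermiteMoment (1 / 4) 0 := by
    have := hermiteMoment_zero_pos hq hq1
    positivity
  set c := 13 / 4 * hermiteMoment (1 / 4) 0
  have gw := (hasPolyGrowth_quadraticWeight lam).const_mul c⁻¹
  have hcw (y : EuclideanSpace ℝ (Fin 3)) : 0 ≤ c⁻¹ * quadraticWeight lam y :=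
    mul_nonneg (inv_nonneg.2 hc.le) (hw0 y)
  set μ := (stdGaussian (EuclideanSpace ℝ (Fin 3))).withDensity
    fun y ↦ ENNReal.ofReal (c⁻¹ * quadraticWeight lam y) with hμ
  have fin : IsFiniteMeasure μ := isFiniteMeasure_withDensity_ofReal (gw.integrable _).2
  have int_eq (f : EuclideanSpace ℝ (Fin 3) → ℝ) :
      ∫ y, f y ∂μ = ∫ y, c⁻¹ * quadraticWeight lam y * f y ∂stdGaussian _ := by
    rw [hμ, integral_withDensity_eq_integral_toReal_smul gw.1.ennreal_ofReal
      (ae_of_all _ fun _ ↦ ENNReal.ofReal_lt_top)]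
    simp [ENNReal.toReal_ofReal (hcw _)]
  have rep (x : EuclideanSpace ℝ (Fin 3)) :
      ∫ y, |inner ℝ x y| ^ (1 / 4 : ℝ) ∂μ = perturbedNorm lam x.ofLp ^ (1 / 4 : ℝ) := by
    have := gaussCosine_quadraticWeight h0 (by linarith) x
    rw [int_eq, ← inv_mul_cancel_left₀ hc.ne' (perturbedNorm lam x.ofLp ^ (1 / 4 : ℝ)), ← this,
      gaussCosine, ← integral_const_mul]
    congr 1 with y
    ring
  have nz : NeZero μ := ⟨fun h ↦ by
    have h2 := rep (EuclideanSpace.single 0 1)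
    rw [h, integral_zero_measure, perturbedNorm_ofLp_rpow h0 (by linarith)] at h2
    norm_num [show (2 : Fin 3) ≠ 0 by decide] at h2
    linarith⟩
  refine embedsIsometricallyInL_of_measure (μ := μ) (by simp) (by simp) ?_ ?_
  · rw [ht, hμ, integrable_withDensity_iff_integrable_smul' gw.1.ennreal_ofReal
      (ae_of_all _ fun _ ↦ ENNReal.ofReal_lt_top)]
    refine ((gw.mul (HasPolyGrowth.norm_rpow hq.le hq1)).integrable _).congr
      (ae_of_all _ fun y ↦ ?_)
    simp [ENNReal.toReal_ofReal (hcw _)]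
  · rw [ht]
    exact rep

theorem le_of_embedsIsometricallyInL_one_quarter {lam : ℝ} (h0 : 0 < lam)
    {hN : IsNorm (perturbedNorm lam)}
    (h : EmbedsIsometricallyInL (NormedBy (perturbedNorm lam) hN) (1 / 4)) : lam ≤ 1 / 26 := by
  have h1 := le_of_isNorm_perturbedNorm h0 hN
  obtain ⟨μ, hμ, hint, hrep⟩ := h.exists_measure (by simp) (by simp)
  rw [show ((1 : ℝ≥0∞) / 4).toReal = 1 / 4 by simp] at hint hrep
  have hc := hermiteMoment_zero_pos (q := 1 / 4) (by norm_num) (by norm_num)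
  have key := nonneg_of_gaussCosine_eq (by norm_num) (by norm_num)
    (u := EuclideanSpace.single 2 (1 : ℝ)) (by simp) hint (hasPolyGrowth_quadraticWeight lam)
    (c := 13 / 4 * hermiteMoment (1 / 4) 0) (by positivity)
    (fun x ↦ by rw [hrep, gaussCosine_quadraticWeight h0 (by linarith)])
    -- Here `p` is the polar value of the weight and `p + D` its equatorial value `1 + 13 * lam`;
    -- the bound is an equality.
    (d := 2) (p := 1 - 26 * lam) (D := 39 * lam) (by positivity) (fun y ↦ by
      obtain ⟨hn, ht⟩ := norm_sq_eq_div_norm_sq y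
      simp only [EuclideanSpace.inner_single_left, map_one, one_mul, quadraticWeight]
      refine le_of_eq ?_
      linear_combination (-1 - 13 * lam) * hn + 39 * lam * ht)
  linarith

theorem not_embedsIsometricallyInL_one_half {lam : ℝ} (h0 : 1 / 28 < lam)
    {hN : IsNorm (perturbedNorm lam)} :
    ¬ EmbedsIsometricallyInL (NormedBy (perturbedNorm lam) hN) (1 / 2) := by
  intro h
  have hpos : 0 < lam := by linarith
  have h1 := le_of_isNorm_perturbedNorm hpos hN
  obtain ⟨μ, hμ, hint, hrep⟩ := h.exists_measure (by simp) (by simp)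
  rw [show ((1 : ℝ≥0∞) / 2).toReal = 1 / 2 by simp] at hint hrep
  have hc := hermiteMoment_zero_pos (q := 1 / 2) (by norm_num) (by norm_num)
  have key := nonneg_of_gaussCosine_eq (by norm_num) (by norm_num)
    (u := EuclideanSpace.single 2 (1 : ℝ)) (by simp) hint (hasPolyGrowth_quarticWeight lam)
    (c := 77 / 4 * hermiteMoment (1 / 2) 0) (by positivity)
    (fun x ↦ by rw [hrep, gaussCosine_quarticWeight hpos (by linarith)])
    -- `D` is chosen so that the coefficients of `(y₀² + y₁²) y₂²` agree as well as those of `y₂⁴`;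
    -- the bound then exceeds the weight by `231 λ² (y₀² + y₁²)²`.
    (d := 4) (p := 1 - 28 * lam - 44 * lam ^ 2) (D := 42 * lam + 252 * lam ^ 2) (by positivity)
    (fun y ↦ by
      obtain ⟨hn, ht⟩ := norm_sq_eq_div_norm_sq y
      simp only [EuclideanSpace.inner_single_left, map_one, one_mul, quarticWeight]
      rw [show ‖y‖ ^ 4 * (1 - 28 * lam - 44 * lam ^ 2 + (42 * lam + 252 * lam ^ 2) *
          (1 - (y 2 / ‖y‖) ^ 2)) = ‖y‖ ^ 2 * (‖y‖ ^ 2 * (1 - 28 * lam - 44 * lam ^ 2) +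
          (42 * lam + 252 * lam ^ 2) * (‖y‖ ^ 2 - ‖y‖ ^ 2 * (y 2 / ‖y‖) ^ 2)) by ring, ht, hn]
      have : 0 ≤ (lam * (y 0 ^ 2 + y 1 ^ 2)) ^ 2 := sq_nonneg _
      nlinarith)
  nlinarith

lemma completeSpace_normedBy {lam : ℝ} (hN : IsNorm (perturbedNorm lam)) :
    CompleteSpace (NormedBy (perturbedNorm lam) hN) := by
  have : FiniteDimensional ℝ (NormedBy (perturbedNorm lam) hN) :=
    inferInstanceAs (FiniteDimensional ℝ (Fin 3 → ℝ))
  exact FiniteDimensional.complete ℝ _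

end PerturbedNorm

theorem theorem2 (lam : ℝ) (hlam : 0 < lam) :
    (IsNorm (perturbedNorm lam) ↔ lam ≤ 1 / 23) ∧
    (∀ hN : IsNorm (perturbedNorm lam),
      (EmbedsIsometricallyInL (NormedBy (perturbedNorm lam) hN) (1 / 4) ↔ lam ≤ 1 / 26) ∧
      (1 / 28 < lam → ¬ EmbedsIsometricallyInL (NormedBy (perturbedNorm lam) hN) (1 / 2))) ∧
    (1 / 28 < lam → lam ≤ 1 / 26 →
      ∃ hN : IsNorm (perturbedNorm lam),
        CompleteSpace (NormedBy (perturbedNorm lam) hN) ∧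
        EmbedsIsometricallyInL (NormedBy (perturbedNorm lam) hN) (1 / 4) ∧
        ¬ EmbedsIsometricallyInL (NormedBy (perturbedNorm lam) hN) (1 / 2)) := by
  refine ⟨isNorm_perturbedNorm_iff hlam, fun hN ↦ ⟨⟨le_of_embedsIsometricallyInL_one_quarter hlam,
    fun h ↦ embedsIsometricallyInL_one_quarter hlam h hN⟩,
    fun h ↦ not_embedsIsometricallyInL_one_half h⟩, fun h h' ↦ ?_⟩
  have hN := isNorm_perturbedNorm hlam (by linarith : lam ≤ 1 / 23)
  exact ⟨hN, completeSpace_normedBy hN, embedsIsometricallyInL_one_quarter hlam h' hN,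
    not_embedsIsometricallyInL_one_half h⟩
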